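/- For a permutation $\pi=\pi_1\cdots\pi_n$ of $[n]=\{1,\dots,n\}$ let $\mathrm{des}(\pi)=|\{i\in[n-1]:\pi_i>\pi_{i+1}\}|$, $\mathrm{exc}(\pi)=|\{i\in[n-1]:\pi_i>i\}|$, $\mathrm{maj}(\pi)=\sum_{i\in[n-1],\,\pi_i>\pi_{i+1}} i$ and $\mathrm{inv}(\pi)=|\{(i,j)\in[n]\times[n]: i<j,\ \pi_i>\pi_j\}|$. With the convention $\pi_{n+1}=+\infty$, let $\mathrm{dd}(\pi)=|\{i: 2\le i\le n,\ \pi_{i-1}>\pi_i>\pi_{i+1}\}|$ be the number of non-initial double descents of $\pi$. Let $q$ and $t$ be indeterminates, $(q;q)_n=\prod_{i=1}^n(1-q^i)$ and $\binom{n}{m}_q=\frac{(q;q)_n}{(q;q)_m\,(q;q)_{n-m}}$ for $0\le m\le n$. Define $$A_n(t,q)=\sum_{\pi\in\mathfrak S_n}t^{\mathrm{exc}(\pi)}q^{\mathrm{maj}(\pi)-\mathrm{exc}(\pi)},\qquad \tilde A_n(t,q)=1+t\sum_{m=1}^n\binom{n}{m}_q A_m(t,q).$$ **Theorem.** For every $n\ge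 0$, $$\tilde A_n(t,q)=\sum_{k=0}^{\lfloor n/2\rfloor}\tilde\gamma_{n,k}(q)\,t^k(1+t)^{n-2k},\qquad\text{where}\qquad \tilde\gamma_{n,k}(q)=\sum_{\substack{\pi\in\mathfrak S_n\\ \mathrm{dd}(\pi)=0,\ \mathrm{des}(\pi)=k}}q^{\mathrm{inv}(\pi)}.$$ -/

import Mathlib

namespace QBinEul

section Statistics

/-- The letter `σ_i` (positions `i = 1, …, n`, letters `1, …, n`) of a permutation `σ` of `[n]`,
with `σ_i = +∞` for every other `i`; in particular `σ_0 = σ_{n+1} = +∞`. -/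
def letter {n : ℕ} (σ : Equiv.Perm (Fin n)) (i : ℕ) : WithTop ℕ :=
  if h : 1 ≤ i ∧ i ≤ n then ((((σ ⟨i - 1, by omega⟩ : Fin n) : ℕ) + 1 : ℕ) : WithTop ℕ) else ⊤

/-- The set of descents `{i ∈ [n-1] : σ_i > σ_{i+1}}`. -/
def descents {n : ℕ} (σ : Equiv.Perm (Fin n)) : Finset ℕ :=
  (Finset.Icc 1 (n - 1)).filter fun i => letter σ (i + 1) < letter σ i

/-- The number of descents. -/
def des {n : ℕ} (σ : Equiv.Perm (Fin n)) : ℕ := (descents σ).card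

/-- The number of excedances, `|{i ∈ [n-1] : σ_i > i}|`. -/
def exc {n : ℕ} (σ : Equiv.Perm (Fin n)) : ℕ :=
  ((Finset.Icc 1 (n - 1)).filter fun i : ℕ => (i : WithTop ℕ) < letter σ i).card

/-- The inversion number, `|{(i,j) ∈ [n] × [n] : i < j, σ_i > σ_j}|`. -/
def inv {n : ℕ} (σ : Equiv.Perm (Fin n)) : ℕ :=
  ((Finset.Icc 1 n ×ˢ Finset.Icc 1 n).filter fun p =>
    p.1 < p.2 ∧ letter σ p.2 < letter σ p.1).card

/-- The major index, the sum of the descents. -/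
def maj {n : ℕ} (σ : Equiv.Perm (Fin n)) : ℕ := ∑ i ∈ descents σ, i

/-- The number of non-initial double descents: positions `2 ≤ i ≤ n` such that
`σ_{i-1} > σ_i > σ_{i+1}`, where `σ_{n+1} = +∞`. -/
def dd {n : ℕ} (σ : Equiv.Perm (Fin n)) : ℕ :=
  ((Finset.Icc 2 n).filter fun i =>
    letter σ i < letter σ (i - 1) ∧ letter σ (i + 1) < letter σ i).card

/-- The set of permutations of `[n]` with no non-initial double descent and `k` descents. -/
def gammaSet (n k : ℕ) : Finset (Equiv.Perm (Fin n)) :=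
  Finset.univ.filter fun σ => dd σ = 0 ∧ des σ = k

end Statistics

noncomputable section

/-- The indeterminate `q`, in the field `ℚ(q)` of rational functions. -/
abbrev q : RatFunc ℚ := RatFunc.X

/-- The indeterminate `t`, in the ring `ℚ(q)[t]`. -/
abbrev t : Polynomial (RatFunc ℚ) := Polynomial.X

/-- `(q;q)_n = ∏_{i=1}^n (1 - q^i)`. -/
def qPoch (n : ℕ) : RatFunc ℚ := ∏ i ∈ Finset.Icc 1 n, (1 - q ^ i)

/-- The `q`-binomial coefficient `(q;q)_n / ((q;q)_m (q;q)_{n-m})`, for `m ≤ n`. -/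
def qBinom (n m : ℕ) : RatFunc ℚ := qPoch n / (qPoch m * qPoch (n - m))

/-- The (maj, exc)-`q`-Eulerian polynomial `A_n(t,q) = ∑_σ t^{exc σ} q^{maj σ - exc σ}`
(the exponent of `q` is an integer difference). -/
def qEulerian (n : ℕ) : Polynomial (RatFunc ℚ) :=
  ∑ σ : Equiv.Perm (Fin n),
    Polynomial.C (q ^ ((maj σ : ℤ) - (exc σ : ℤ))) * t ^ exc σ

/-- The `q`-binomial-Eulerian polynomial
`1 + t ∑_{m=1}^n [n choose m]_q A_m(t,q)`. -/
def qBinomialEulerian (n : ℕ) : Polynomial (RatFunc ℚ) :=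
  1 + t * ∑ m ∈ Finset.Icc 1 n, Polynomial.C (qBinom n m) * qEulerian m

/-- `∑ q^{inv π}` over the permutations `π` of `[n]` with no non-initial double descent and
`k` descents. -/
def gammaCoeff (n k : ℕ) : RatFunc ℚ := ∑ π ∈ gammaSet n k, q ^ inv π

end

end QBinEul

/-! Write `e_j(n)` for the elementary symmetric polynomial of `1, q, …, q^(n-1)`, which is `q^(j
choose 2)` times the `q`-binomial coefficient, and `Γ_n` for the right-hand side. Both sides are
identified with one auxiliary sequence `F_n`.

The sequence `Γ_n`: a permutation without double descents is built by prepending one letter, or two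
letters when the first position is a descent. Refined by the first letter, this gives a recursion
that `bounded_sum_eq` solves; hence `∑_j (-1)^j (1 + t + ⋯ + t^j) e_j(n) Γ_(n-j) = δ_(n,0)`
(`gammaSum_recurrence`), which determines `Γ`.

The sequence `F_n`: in variables `X_0, …, X_(N-1)` put `L_k = t ∑_{l ≥ k} X_l + ∑_{l ≤ k} X_l`. Sum
the coefficients of `X^c` in `∏ L_k^(c_k)`, weighted by `q^(∑ k c_k)`, over `c` of size `n`
(`plainSum`); `F_n` is the limit of `(q;q)_n` times this as `N → ∞`. The limit is formal: the
constant term of a polynomial in `q^N` (`HasQLim`). Replacing one factor `L_k` by `L_k - τ X_k` for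
each `k` in the support of `c` gives `markedSum`, which expands as `∑_j (-τ)^j e_j(N) plainSum(n-j)`
(`markedSum_eq`). Two facts are known about it. For `n > 0`, its value at `τ = 1` is `t` times its
value at `τ = t`, by a telescoping product (`markedSum_one`). At `τ = t` it counts words; grouped by
their stable sorting permutation they yield `∑_σ (t/q)^exc` times a generating function of sequences
with prescribed drops (`sum_perm_eq_markedSum`), whose normalised limit is `A_n(t,q)`.

In the limit (`exists_relations`), `A_n = ∑_j (-t)^j e_j(n) F_(n-j)` and `(1-t) δ_(n,0) + t A_n =
∑_j (-1)^j e_j(n) F_(n-j)`. The second minus `t` times the first, divided by `1 - t`, is the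
recurrence of `Γ`, so `F = Γ` (`eq_gammaSum_of_relations`). Inverting the second by `q`-binomial
inversion gives `F_n` as the `q`-binomial-Eulerian polynomial (`eq_sum_binom_of_relation`). -/

namespace QEulerGamma

open Finset

/-! ### Elementary symmetric polynomials of a geometric progression. -/

section Elementary

variable {R : Type*} [CommRing R]

/-- The elementary symmetric polynomial of degree `j` in `1, q, …, q ^ (n - 1)`. -/
def es (q : R) : ℕ → ℕ → R
  | 0, _ => 1
  | _ + 1, 0 => 0
  | j + 1, n + 1 => es q (j + 1) n + q ^ n * es q j n

theorem es_zero (q : R) (n : ℕ) : es q 0 n = 1 := by cases n <;> rfl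

theorem es_succ_zero (q : R) (j : ℕ) : es q (j + 1) 0 = 0 := rfl

theorem es_succ_succ (q : R) (j n : ℕ) :
    es q (j + 1) (n + 1) = es q (j + 1) n + q ^ n * es q j n := rfl

theorem sum_range_mul_es (q : R) (j p : ℕ) :
    ∑ a ∈ range p, q ^ a * es q j a = es q (j + 1) p := by
  induction p with
  | zero => simp [es_succ_zero]
  | succ p ih => rw [sum_range_succ, ih, es_succ_succ]

theorem es_eq_zero_of_lt (q : R) {j n : ℕ} (h : n < j) : es q j n = 0 := by
  induction n generalizing j with
  | zero => obtain ⟨j, rfl⟩ := Nat.exists_eq_succ_of_ne_zero h.ne'; rfl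
  | succ n ih =>
    obtain ⟨j, rfl⟩ := Nat.exists_eq_succ_of_ne_zero (Nat.ne_zero_of_lt h)
    rw [es_succ_succ, ih (by omega), ih (by omega)]; simp

theorem sum_pow_mul_es (q x : R) (n : ℕ) :
    ∑ j ∈ range (n + 1), x ^ j * es q j n = ∏ i ∈ range n, (1 + x * q ^ i) := by
  induction n with
  | zero => simp [es_zero]
  | succ n ih =>
    rw [sum_range_succ', prod_range_succ, ← ih]
    simp only [es_succ_succ, es_zero, mul_add, sum_add_distrib]
    have h1 : ∑ j ∈ range (n + 1), x ^ (j + 1) * es q (j + 1) n + x ^ 0 * 1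
        = ∑ j ∈ range (n + 1), x ^ j * es q j n := by
      rw [← es_zero q n, ← sum_range_succ' (fun j => x ^ j * es q j n), sum_range_succ,
        es_eq_zero_of_lt q (Nat.lt_succ_self n)]
      simp
    have h2 : ∑ j ∈ range (n + 1), x ^ (j + 1) * (q ^ n * es q j n)
        = (∑ j ∈ range (n + 1), x ^ j * es q j n) * (x * q ^ n) := by
      rw [sum_mul]; refine sum_congr rfl fun j _ => by ring
    rw [h2, ← h1]; ring

/-- At `x = -1` the factor `1 + x q^0` vanishes. -/
theorem sum_neg_one_pow_mul_es (q : R) (n : ℕ) :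
    ∑ j ∈ range (n + 1), (-1) ^ j * es q j n = if n = 0 then 1 else 0 := by
  rw [sum_pow_mul_es]
  rcases n with _ | n
  · simp
  · rw [prod_range_succ']; simp

theorem es_eq_sum_powersetCard (q : R) (j n : ℕ) :
    es q j n = ∑ J ∈ powersetCard j (range n), ∏ i ∈ J, q ^ i := by
  induction n generalizing j with
  | zero =>
    rcases j with _ | j
    · simp [es_zero]
    · rw [powersetCard_eq_empty.2 (by simp), es_succ_zero, sum_empty]
  | succ n ih =>
    rcases j with _ | j
    · simp [es_zero]
    · rw [es_succ_succ, range_add_one, powersetCard_succ_insert notMem_range_self, sum_union, ih,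
        ih, mul_sum, sum_image]
      · congr 1
        refine sum_congr rfl fun J hJ => ?_
        rw [prod_insert]
        intro h
        simpa using (mem_powersetCard.1 hJ).1 h
      · intro J hJ K hK h
        have hn : ∀ J ∈ powersetCard j (range n), n ∉ J := fun J hJ h => by
          simpa using (mem_powersetCard.1 hJ).1 h
        rw [← erase_insert (hn J hJ), ← erase_insert (hn K hK)]
        exact congrArg (fun s => erase s n) h
      · rw [disjoint_left]
        intro J hJ hK
        obtain ⟨K, -, rfl⟩ := mem_image.1 hK
        simpa using (mem_powersetCard.1 hJ).1 (mem_insert_self n K)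

/-- The product `(1 - q) (1 - q ^ 2) ⋯ (1 - q ^ n)`. -/
def qp (q : R) (n : ℕ) : R := ∏ i ∈ range n, (1 - q ^ (i + 1))

theorem qp_succ (q : R) (n : ℕ) : qp q (n + 1) = qp q n * (1 - q ^ (n + 1)) :=
  prod_range_succ _ _

/-- A division-free `q`-binomial formula. It also holds for `j > n`: the factor with `i = n` is then
`1 - q^0 = 0`. -/
theorem qp_mul_es (q : R) (j n : ℕ) :
    qp q j * es q j n = q ^ j.choose 2 * ∏ i ∈ range j, (1 - q ^ (n - i)) := by
  induction n generalizing j with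
  | zero =>
    rcases j with _ | j
    · simp [es_zero, qp]
    · rw [es_succ_zero, prod_range_succ']; simp
  | succ n ih =>
    rcases j with _ | j
    · simp [es_zero, qp]
    · have hc : (j + 1).choose 2 = j.choose 2 + j := by
        rw [Nat.choose_succ_succ' j 1]; simp [add_comm]
      have e : qp q (j + 1) * es q (j + 1) (n + 1) = qp q (j + 1) * es q (j + 1) n
          + q ^ n * (1 - q ^ (j + 1)) * (qp q j * es q j n) := by
        rw [es_succ_succ, qp_succ]; ring
      rw [e, ih, ih, hc, prod_range_succ, prod_range_succ' _ j]
      simp only [Nat.add_sub_add_right, Nat.sub_zero]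
      rcases le_or_gt j n with h | h
      · obtain ⟨m, rfl⟩ := Nat.exists_eq_add_of_le h
        rw [Nat.add_sub_cancel_left]
        ring
      · rw [prod_eq_zero (i := n) (mem_range.2 h) (by simp)]; simp

end Elementary

/-! ### Solving the recursion by first letter. -/

section Recurrence

variable {R : Type*} [CommRing R]

/-- The sum `1 + t + ⋯ + t ^ (k - 1)`. -/
def tn (t : R) (k : ℕ) : R := ∑ i ∈ range k, t ^ i

theorem tn_succ (t : R) (k : ℕ) : tn t (k + 1) = tn t k + t ^ k := sum_range_succ _ _

theorem one_sub_mul_tn (t : R) (k : ℕ) : (1 - t) * tn t k = 1 - t ^ k := by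
  rw [tn, mul_comm]; exact geom_sum_mul_neg t k

/-- In the application `G` is `Γ` and `Gd n p` its part with first letter below `p`. Each summation
`∑_{a < p} q^a` raises the degree of `e_j` by one, and the coefficients match because `(1 + t)[j+2]
- t[j+1] = [j+3]`, where `[k] = 1 + t + ⋯ + t^(k-1)`. -/
theorem bounded_sum_eq (q t : R) (G : ℕ → R) (Gd : ℕ → ℕ → R) (h0 : ∀ p, Gd 0 p = 0)
    (hrec : ∀ n p, p ≤ n + 1 → Gd (n + 1) p = ∑ a ∈ range p, q ^ a * ((1 + t) * (G n - Gd n a) +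
      t * ∑ b ∈ range a, q ^ b * (G (n - 1) - Gd (n - 1) b))) (n p : ℕ) (hp : p ≤ n) :
    Gd n p = ∑ j ∈ range n, (-1) ^ j * tn t (j + 2) * es q (j + 1) p * G (n - 1 - j) := by
  induction n using Nat.strong_induction_on generalizing p with
  | _ n ih =>
  have key : ∀ m a, m < n → a ≤ m → G m - Gd m a =
      ∑ j ∈ range (m + 1), (-1) ^ j * tn t (j + 1) * es q j a * G (m - j) := by
    intro m a hm ha
    rw [ih m hm a ha, sum_range_succ', sub_eq_add_neg, add_comm, ← sum_neg_distrib]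
    congr 1
    · refine sum_congr rfl fun j _ => ?_
      rw [show m - 1 - j = m - (j + 1) by omega]; ring
    · simp [tn, es_zero]
  rcases n with _ | n
  · simp [h0]
  · have key2 : ∀ m k, m < n + 1 → k ≤ m + 1 → ∑ b ∈ range k, q ^ b * (G m - Gd m b) =
        ∑ j ∈ range (m + 1), (-1) ^ j * tn t (j + 1) * es q (j + 1) k * G (m - j) := by
      intro m k hm hk
      have : ∀ b ∈ range k, q ^ b * (G m - Gd m b) =
          ∑ j ∈ range (m + 1), (-1) ^ j * tn t (j + 1) * G (m - j) * (q ^ b * es q j b) := by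
        intro b hb
        rw [key m b hm (by have := mem_range.1 hb; omega), mul_sum]
        refine sum_congr rfl fun j _ => by ring
      rw [sum_congr rfl this, sum_comm]
      refine sum_congr rfl fun j _ => ?_
      rw [← mul_sum, sum_range_mul_es]; ring
    rw [hrec n p hp]
    simp only [mul_add, sum_add_distrib]
    have e1 : ∑ a ∈ range p, q ^ a * ((1 + t) * (G n - Gd n a)) =
        (1 + t) * ∑ a ∈ range p, q ^ a * (G n - Gd n a) := by
      rw [mul_sum]; refine sum_congr rfl fun a _ => by ring
    rw [e1, key2 n p (by omega) hp]
    -- At `n = 0` the index `n - 1` is truncated; this is harmless because `p ≤ 1` leaves only `a =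
    -- 0`, whose inner sum is empty.
    rcases n with _ | n
    · have : ∑ a ∈ range p, q ^ a * (t * ∑ b ∈ range a, q ^ b * (G (0 - 1) - Gd (0 - 1) b)) = 0 := by
        refine sum_eq_zero fun a ha => ?_
        have : a = 0 := by have := mem_range.1 ha; omega
        simp [this]
      rw [this]
      simp [tn, sum_range_succ]
      ring
    · have e2 : ∑ a ∈ range p, q ^ a * (t * ∑ b ∈ range a, q ^ b * (G (n + 1 - 1) - Gd (n + 1 - 1) b))
          = t * ∑ j ∈ range (n + 1), (-1) ^ j * tn t (j + 1) * es q (j + 2) p * G (n - j) := by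
        have : ∀ a ∈ range p, q ^ a * (t * ∑ b ∈ range a,
            q ^ b * (G (n + 1 - 1) - Gd (n + 1 - 1) b)) = ∑ j ∈ range (n + 1),
              t * ((-1) ^ j * tn t (j + 1) * G (n - j)) * (q ^ a * es q (j + 1) a) := by
          intro a ha
          rw [Nat.add_sub_cancel, key2 n a (by omega) (by have := mem_range.1 ha; omega),
            mul_sum, mul_sum]
          refine sum_congr rfl fun j _ => by ring
        rw [sum_congr rfl this, sum_comm, mul_sum]
        refine sum_congr rfl fun j _ => ?_
        rw [← mul_sum, sum_range_mul_es]; ring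
      rw [e2, sum_range_succ', sum_range_succ' _ (n + 1), mul_add, mul_sum, mul_sum, add_right_comm,
        ← sum_add_distrib]
      congr 1
      · refine sum_congr rfl fun j _ => ?_
        rw [show n + 1 - (j + 1) = n - j by omega, show n + 1 + 1 - 1 - (j + 1) = n - j by omega]
        simp only [tn_succ, show j + 1 + 2 = j + 2 + 1 by ring, show j + 1 + 1 = j + 2 by ring]
        ring
      · simp [tn, sum_range_succ]; ring

end Recurrence

/-! ### Decreasing sequences with prescribed drops. -/

section Sequences

variable {R : Type*} [CommRing R]

open Classical in
/-- The generating polynomial by sum of the sequences `b` with entries below `M` and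
`b i ≥ b (i + 1) + d i`. -/
noncomputable def dropSum (q : R) (M n : ℕ) (d : ℕ → ℕ) : R :=
  ∑ b ∈ (Fintype.piFinset fun _ : Fin n => range M).filter
    (fun b => ∀ (i : ℕ) (h : i + 1 < n), b ⟨i + 1, h⟩ + d i ≤ b ⟨i, by omega⟩), q ^ ∑ i, b i

theorem dropSum_zero (q : R) (M : ℕ) (d : ℕ → ℕ) : dropSum q M 0 d = 1 := by
  classical
  unfold dropSum
  rw [filter_true_of_mem (by intro b _ i h; omega)]
  simp

theorem dropSum_eq_zero (q : R) (n : ℕ) (d : ℕ → ℕ) :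
    dropSum q (∑ i ∈ range n, d i) (n + 1) d = 0 := by
  classical
  unfold dropSum
  rw [filter_eq_empty_iff.2, sum_empty]
  intro b hb h
  have key : ∀ k (hk : k < n + 1), b ⟨k, hk⟩ + ∑ i ∈ range k, d i ≤ b 0 := by
    intro k
    induction k with
    | zero => intro hk; simp
    | succ k ih =>
      intro hk
      have h1 := ih (by omega)
      have h2 := h k hk
      rw [sum_range_succ]; omega
  have h1 := key n (by omega)
  have h2 := mem_range.1 (Fintype.mem_piFinset.1 hb 0)
  omega

/-- The first entry is the largest: either it is below `M`, or it equals `M` and its removal leaves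
a shorter sequence bounded by `M - d 0`. -/
theorem dropSum_succ_succ (q : R) (M n : ℕ) (d : ℕ → ℕ) (hd : d 0 ≤ M) :
    dropSum q (M + 1) (n + 2) d = dropSum q M (n + 2) d +
      q ^ M * dropSum q (M + 1 - d 0) (n + 1) (fun i => d (i + 1)) := by
  classical
  unfold dropSum
  rw [← sum_filter_add_sum_filter_not _ (fun b : Fin (n + 2) → ℕ => b 0 < M)]
  congr 1
  · refine sum_congr ?_ fun _ _ => rfl
    ext b
    simp only [mem_filter, Fintype.mem_piFinset, mem_range]
    constructor
    · rintro ⟨⟨h1, h2⟩, h3⟩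
      refine ⟨?_, h2⟩
      have key : ∀ k (hk : k < n + 2), b ⟨k, hk⟩ ≤ b 0 := by
        intro k
        induction k with
        | zero => intro hk; exact le_rfl
        | succ k ih =>
          intro hk
          exact (Nat.le_of_add_right_le (h2 k hk)).trans (ih _)
      exact fun a => (key a.1 a.2).trans_lt h3
    · rintro ⟨h1, h2⟩
      exact ⟨⟨fun a => (h1 a).trans (Nat.lt_succ_self M), h2⟩, h1 0⟩
  · rw [mul_sum]
    refine sum_nbij' (fun b => Fin.tail b) (fun b => Fin.cons M b) ?_ ?_ ?_ ?_ ?_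
    · intro b hb
      simp only [mem_filter, Fintype.mem_piFinset, mem_range, not_lt] at hb ⊢
      obtain ⟨⟨h1, h2⟩, h3⟩ := hb
      have h0 : b 0 = M := le_antisymm (Nat.lt_succ_iff.1 (h1 0)) h3
      refine ⟨?_, fun i hi => h2 (i + 1) (by omega)⟩
      have key : ∀ k (hk : k < n + 1), b ⟨k + 1, by omega⟩ + d 0 ≤ b 0 := by
        intro k
        induction k with
        | zero => intro hk; exact h2 0 (by omega)
        | succ k ih =>
          intro hk
          have := h2 (k + 1) (by omega)
          have := ih (by omega)
          omega
      intro a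
      have := key a.1 a.2
      have e : Fin.tail b a = b ⟨a.1 + 1, by omega⟩ := rfl
      omega
    · intro b hb
      simp only [mem_filter, Fintype.mem_piFinset, mem_range, not_lt] at hb ⊢
      obtain ⟨h1, h2⟩ := hb
      refine ⟨⟨?_, ?_⟩, by simp⟩
      · intro a
        refine Fin.cases ?_ (fun a => ?_) a
        · simp
        · have := h1 a
          simp only [Fin.cons_succ]; omega
      · intro i hi
        rcases i with _ | i
        · have e1 : (Fin.cons M b : Fin (n + 2) → ℕ) ⟨0 + 1, hi⟩ = b 0 := rfl
          have e2 : (Fin.cons M b : Fin (n + 2) → ℕ) ⟨0, by omega⟩ = M := rfl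
          have := h1 0
          rw [e1, e2]; omega
        · exact h2 i (by omega)
    · intro b hb
      simp only [mem_filter, Fintype.mem_piFinset, mem_range, not_lt] at hb
      have h0 : b 0 = M := le_antisymm (Nat.lt_succ_iff.1 (hb.1.1 0)) hb.2
      rw [← h0]; exact Fin.cons_self_tail b
    · intro b _; exact Fin.tail_cons _ _
    · intro b hb
      simp only [mem_filter, Fintype.mem_piFinset, mem_range, not_lt] at hb
      have h0 : b 0 = M := le_antisymm (Nat.lt_succ_iff.1 (hb.1.1 0)) hb.2
      rw [← pow_add, Fin.sum_univ_succ, h0]; rfl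

theorem dropSum_one (q : R) (M : ℕ) (d : ℕ → ℕ) : dropSum q M 1 d = ∑ j ∈ range M, q ^ j := by
  classical
  unfold dropSum
  rw [filter_true_of_mem (by intro b _ i h; omega)]
  refine sum_nbij' (fun b => b 0) (fun j _ => j) ?_ ?_ ?_ ?_ ?_
  · intro b hb; exact Fintype.mem_piFinset.1 hb 0
  · intro j hj; exact Fintype.mem_piFinset.2 fun _ => hj
  · intro b _; ext i; rw [Subsingleton.elim i 0]
  · intro j _; rfl
  · intro b _; simp

/-- Subtracting the forced drops from the right leaves a partition with `n + 1` parts below `M`, and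
removes `∑ (i + 1) d i` in total. The `q`-binomial coefficient so predicted is checked by induction,
through the Pascal-type rule `dropSum_succ_succ`. -/
theorem qp_mul_dropSum (q : R) (n M : ℕ) (d : ℕ → ℕ) :
    qp q (n + 1) * dropSum q (M + ∑ i ∈ range n, d i) (n + 1) d =
      q ^ (∑ i ∈ range n, (i + 1) * d i) * ∏ i ∈ range (n + 1), (1 - q ^ (M + i)) := by
  induction n generalizing M d with
  | zero =>
    rw [dropSum_one]
    simp only [qp, range_one, prod_singleton, range_zero, sum_empty, pow_zero, one_mul, add_zero,
      zero_add, pow_one]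
    rw [mul_comm]; exact geom_sum_mul_neg q M
  | succ n ih =>
    induction M with
    | zero =>
      rw [zero_add, dropSum_eq_zero, prod_range_succ']; simp
    | succ M ihM =>
      have e : ∑ i ∈ range (n + 1), d i = ∑ i ∈ range n, d (i + 1) + d 0 := sum_range_succ' _ _
      have e2 : ∑ i ∈ range (n + 1), (i + 1) * d i =
          ∑ i ∈ range n, (i + 1) * d (i + 1) + ∑ i ∈ range (n + 1), d i := by
        rw [sum_range_succ', e, ← add_assoc, ← sum_add_distrib]
        simp only [zero_add, one_mul]
        congr 1
        refine sum_congr rfl fun i _ => by ring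
      rw [show M + 1 + ∑ i ∈ range (n + 1), d i = M + ∑ i ∈ range (n + 1), d i + 1 by ring,
        dropSum_succ_succ _ _ _ _ (by omega), mul_add, ihM,
        show M + ∑ i ∈ range (n + 1), d i + 1 - d 0 = (M + 1) + ∑ i ∈ range n, d (i + 1) by omega,
        qp_succ, show qp q (n + 1) * (1 - q ^ (n + 1 + 1)) * (q ^ (M + ∑ i ∈ range (n + 1), d i) *
          dropSum q (M + 1 + ∑ i ∈ range n, d (i + 1)) (n + 1) fun i => d (i + 1)) =
          (1 - q ^ (n + 1 + 1)) * q ^ (M + ∑ i ∈ range (n + 1), d i) * (qp q (n + 1) *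
          dropSum q (M + 1 + ∑ i ∈ range n, d (i + 1)) (n + 1) fun i => d (i + 1)) by ring, ih,
        prod_range_succ' (fun i => 1 - q ^ (M + i)), prod_range_succ _ (n + 1), e2]
      rw [prod_congr rfl fun i _ => show 1 - q ^ (M + (i + 1)) = 1 - q ^ (M + 1 + i) by
        rw [add_right_comm, add_assoc]]
      simp only [pow_add, pow_zero, pow_one]
      ring

end Sequences

end QEulerGamma

namespace QEulerGamma

open Finset QBinEul

/-! ### Statistics in zero-based form, and prepending a letter to a permutation. -/

section Stats

variable {n : ℕ}

/-- The indicator of a descent at the (zero-based) position `i`. -/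
def dsc (σ : Equiv.Perm (Fin n)) (i : ℕ) : ℕ :=
  if h : i + 1 < n then (if σ ⟨i + 1, h⟩ < σ ⟨i, by omega⟩ then 1 else 0) else 0

theorem dsc_le_one (σ : Equiv.Perm (Fin n)) (i : ℕ) : dsc σ i ≤ 1 := by
  unfold dsc; split_ifs <;> simp

theorem dsc_eq_zero (σ : Equiv.Perm (Fin n)) {i : ℕ} (h : n ≤ i + 1) : dsc σ i = 0 :=
  dif_neg (by omega)

theorem letter_succ (σ : Equiv.Perm (Fin n)) {i : ℕ} (h : i < n) :
    letter σ (i + 1) = (((σ ⟨i, h⟩ : ℕ) + 1 : ℕ) : WithTop ℕ) := by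
  unfold letter; rw [dif_pos ⟨by omega, by omega⟩]; rfl

theorem letter_eq_top (σ : Equiv.Perm (Fin n)) {i : ℕ} (h : n ≤ i) : letter σ (i + 1) = ⊤ := by
  unfold letter; rw [dif_neg (by omega)]

theorem letter_lt_letter_iff (σ : Equiv.Perm (Fin n)) (i : ℕ) (hi : i < n) :
    letter σ (i + 1 + 1) < letter σ (i + 1) ↔ dsc σ i = 1 := by
  unfold dsc
  rw [letter_succ σ hi]
  split_ifs with h h2
  · rw [letter_succ σ h, Nat.cast_lt]; simpa using h2
  · rw [letter_succ σ h, Nat.cast_lt]; simpa using h2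
  · rw [letter_eq_top σ (by omega)]; simp

theorem sum_descents (σ : Equiv.Perm (Fin n)) (f : ℕ → ℕ) :
    ∑ i ∈ descents σ, f i = ∑ i ∈ range (n - 1), f (i + 1) * dsc σ i := by
  unfold descents
  have hI : Icc 1 (n - 1) = Ico 1 (n - 1 + 1) := rfl
  rw [sum_filter, hI, sum_Ico_eq_sum_range, Nat.add_sub_cancel]
  refine sum_congr rfl fun i hi => ?_
  rw [add_comm 1 i]
  have hi' : i < n := by have := mem_range.1 hi; omega
  have := dsc_le_one σ i
  split_ifs with h
  · rw [(letter_lt_letter_iff σ i hi').1 h, mul_one]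
  · rw [letter_lt_letter_iff σ i hi'] at h
    rw [show dsc σ i = 0 by omega, mul_zero]

theorem des_eq (σ : Equiv.Perm (Fin n)) : des σ = ∑ i ∈ range (n - 1), dsc σ i := by
  unfold des
  rw [card_eq_sum_ones, sum_descents]; simp

theorem maj_eq (σ : Equiv.Perm (Fin n)) : maj σ = ∑ i ∈ range (n - 1), (i + 1) * dsc σ i :=
  sum_descents σ _

theorem dd_eq_zero_iff (σ : Equiv.Perm (Fin n)) :
    dd σ = 0 ↔ ∀ i, dsc σ i = 0 ∨ dsc σ (i + 1) = 0 := by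
  unfold dd
  rw [card_eq_zero, filter_eq_empty_iff]
  constructor
  · intro h i
    by_contra! hc
    have h1 : i + 2 < n := by
      by_contra hn
      exact hc.2 (dsc_eq_zero σ (by omega))
    have h2 := dsc_le_one σ i
    have h3 := dsc_le_one σ (i + 1)
    refine h (x := i + 2) (mem_Icc.2 (by omega)) ⟨?_, ?_⟩
    · exact (letter_lt_letter_iff σ i (by omega)).2 (by omega)
    · exact (letter_lt_letter_iff σ (i + 1) (by omega)).2 (by omega)
  · rintro h i hi ⟨h1, h2⟩
    obtain ⟨i, rfl⟩ := Nat.exists_eq_add_of_le (mem_Icc.1 hi).1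
    have hi := mem_Icc.1 hi
    rw [add_comm 2 i] at h1 h2
    have h3 := (letter_lt_letter_iff σ i (by omega)).1 h1
    have h4 := (letter_lt_letter_iff σ (i + 1) (by omega)).1 h2
    rcases h i with h | h <;> omega

theorem exc_eq (σ : Equiv.Perm (Fin n)) :
    exc σ = (univ.filter fun i : Fin n => i < σ i).card := by
  unfold exc
  symm
  refine card_bij (fun i _ => i.1 + 1) ?_ ?_ ?_
  · intro i hi
    have hi := (mem_filter.1 hi).2
    refine mem_filter.2 ⟨mem_Icc.2 ?_, ?_⟩
    · have := (σ i).2; have : i.1 < (σ i).1 := hi; omega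
    · rw [letter_succ σ i.2, Nat.cast_lt]
      exact Nat.succ_lt_succ hi
  · intro i _ j _ h
    exact Fin.ext (Nat.succ_injective h)
  · intro i hi
    obtain ⟨h1, h2⟩ := mem_filter.1 hi
    have h1 := mem_Icc.1 h1
    obtain ⟨i, rfl⟩ := Nat.exists_eq_add_of_le' h1.1
    have hn : i < n := by omega
    rw [letter_succ σ hn, Nat.cast_lt] at h2
    exact ⟨⟨i, hn⟩, mem_filter.2 ⟨mem_univ _, Nat.lt_of_succ_lt_succ h2⟩, rfl⟩

theorem inv_eq (σ : Equiv.Perm (Fin n)) :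
    QBinEul.inv σ = ∑ i : Fin n, ∑ j : Fin n, if i < j ∧ σ j < σ i then 1 else 0 := by
  unfold QBinEul.inv
  rw [← sum_product', ← sum_filter, ← card_eq_sum_ones]
  symm
  refine card_bij (fun p _ => (p.1.1 + 1, p.2.1 + 1)) ?_ ?_ ?_
  · rintro ⟨i, j⟩ h
    obtain ⟨h1, h2⟩ := (mem_filter.1 h).2
    have := i.2
    have := j.2
    refine mem_filter.2 ⟨mem_product.2 ⟨mem_Icc.2 ?_, mem_Icc.2 ?_⟩, Nat.succ_lt_succ h1, ?_⟩
    · dsimp only; omega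
    · dsimp only; omega
    · rw [letter_succ σ i.2, letter_succ σ j.2, Nat.cast_lt]
      exact Nat.succ_lt_succ h2
  · rintro ⟨i, j⟩ _ ⟨i', j'⟩ _ h
    simp only [Prod.mk.injEq, add_left_inj] at h
    exact Prod.ext (Fin.ext h.1) (Fin.ext h.2)
  · rintro ⟨i, j⟩ h
    obtain ⟨h1, h2, h3⟩ := mem_filter.1 h
    obtain ⟨h4, h5⟩ := mem_product.1 h1
    replace h4 : 1 ≤ i ∧ i ≤ n := mem_Icc.1 h4
    replace h5 : 1 ≤ j ∧ j ≤ n := mem_Icc.1 h5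
    dsimp only at h2 h3
    obtain ⟨i, rfl⟩ := Nat.exists_eq_add_of_le' h4.1
    obtain ⟨j, rfl⟩ := Nat.exists_eq_add_of_le' h5.1
    have hi : i < n := by omega
    have hj : j < n := by omega
    rw [letter_succ σ hi, letter_succ σ hj, Nat.cast_lt] at h3
    exact ⟨(⟨i, hi⟩, ⟨j, hj⟩), mem_filter.2 ⟨by simp, Nat.lt_of_succ_lt_succ h2,
      Nat.lt_of_succ_lt_succ h3⟩, rfl⟩

/-- The permutation with first letter `p` whose other letters are in the same relative order as
the letters of `τ`. -/
def consPerm (p : Fin (n + 1)) (τ : Equiv.Perm (Fin n)) : Equiv.Perm (Fin (n + 1)) :=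
  ((finSuccEquiv' 0).trans (Equiv.optionCongr τ)).trans (finSuccEquiv' p).symm

@[simp] theorem consPerm_zero (p : Fin (n + 1)) (τ : Equiv.Perm (Fin n)) :
    consPerm p τ 0 = p := by
  simp [consPerm]

@[simp] theorem consPerm_succ (p : Fin (n + 1)) (τ : Equiv.Perm (Fin n)) (i : Fin n) :
    consPerm p τ i.succ = p.succAbove (τ i) := by
  have h : finSuccEquiv' 0 i.succ = some i := by
    rw [← Fin.zero_succAbove, finSuccEquiv'_succAbove]
  simp [consPerm, h]

theorem sum_perm_succ {M : Type*} [AddCommMonoid M] (f : Equiv.Perm (Fin (n + 1)) → M) :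
    ∑ σ, f σ = ∑ p, ∑ τ, f (consPerm p τ) := by
  rw [← sum_product']
  symm
  refine Fintype.sum_bijective (fun x : Fin (n + 1) × Equiv.Perm (Fin n) => consPerm x.1 x.2) ?_ _ _
    fun _ => rfl
  rw [Fintype.bijective_iff_injective_and_card]
  constructor
  · rintro ⟨p, τ⟩ ⟨p', τ'⟩ h
    have h0 : p = p' := by simpa using congrArg (fun σ => σ 0) h
    subst h0
    refine Prod.ext rfl (Equiv.ext fun i => ?_)
    have := congrArg (fun σ => σ i.succ) h
    simpa using this
  · simp [Fintype.card_perm, Nat.factorial_succ]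

/-- With zero-based values, exactly `p` later letters are smaller than the first letter `p`. -/
theorem inv_consPerm (p : Fin (n + 1)) (τ : Equiv.Perm (Fin n)) :
    QBinEul.inv (consPerm p τ) = p + QBinEul.inv τ := by
  rw [inv_eq, inv_eq, Fin.sum_univ_succ]
  simp only [Fin.sum_univ_succ, consPerm_zero, consPerm_succ, lt_self_iff_false, false_and,
    if_false, Fin.succ_pos, true_and, Fin.not_lt_zero, Fin.succ_lt_succ_iff, zero_add,
    Fin.succAbove_lt_succAbove_iff, Fin.succAbove_lt_iff_castSucc_lt]
  congr 1
  rw [Equiv.sum_comp τ (fun j => if j.castSucc < p then 1 else 0)]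
  have : ∀ j : Fin n, (if j.castSucc < p then 1 else 0) = if j.1 < p.1 then 1 else 0 :=
    fun j => rfl
  simp only [this]
  rw [Fin.sum_univ_eq_sum_range (fun j => if j < p.1 then 1 else 0), ← sum_filter]
  have : (range n).filter (fun j => j < p.1) = range p.1 := by
    ext j; simp only [mem_filter, mem_range]; omega
  rw [this]; simp

theorem dsc_consPerm_succ (p : Fin (n + 1)) (τ : Equiv.Perm (Fin n)) (i : ℕ) :
    dsc (consPerm p τ) (i + 1) = dsc τ i := by
  unfold dsc
  by_cases h : i + 1 < n
  · rw [dif_pos h, dif_pos (by omega)]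
    have h1 : consPerm p τ ⟨i + 1 + 1, by omega⟩ = p.succAbove (τ ⟨i + 1, h⟩) :=
      consPerm_succ p τ ⟨i + 1, h⟩
    have h2 : consPerm p τ ⟨i + 1, by omega⟩ = p.succAbove (τ ⟨i, by omega⟩) :=
      consPerm_succ p τ ⟨i, by omega⟩
    simp only [h1, h2, Fin.succAbove_lt_succAbove_iff]
  · rw [dif_neg h, dif_neg (by omega)]

/-- The first letter of a permutation exists and is less than `p`. -/
def FirstLT (σ : Equiv.Perm (Fin n)) (p : ℕ) : Prop := ∃ h : 0 < n, (σ ⟨0, h⟩ : ℕ) < p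

instance (σ : Equiv.Perm (Fin n)) (p : ℕ) : Decidable (FirstLT σ p) :=
  inferInstanceAs (Decidable (∃ h : 0 < n, (σ ⟨0, h⟩ : ℕ) < p))

theorem dsc_consPerm_zero (p : Fin (n + 1)) (τ : Equiv.Perm (Fin n)) :
    dsc (consPerm p τ) 0 = if FirstLT τ p then 1 else 0 := by
  unfold dsc
  rcases n with _ | n
  · simp [FirstLT]
  · rw [dif_pos (by omega)]
    have h1 : consPerm p τ ⟨0 + 1, by omega⟩ = p.succAbove (τ 0) := consPerm_succ p τ 0
    have h2 : consPerm p τ ⟨0, by omega⟩ = p := consPerm_zero p τ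
    refine if_congr ?_ rfl rfl
    rw [h1, h2, Fin.succAbove_lt_iff_castSucc_lt]
    exact ⟨fun h => ⟨by omega, h⟩, fun ⟨_, h⟩ => h⟩

end Stats

/-! ### The first-letter recursion for permutations without double descents. -/

section Weight

variable {R : Type*} [CommRing R]

open Classical in
/-- The weight `t ^ des * (1 + t) ^ (n - 2 des)` of a descent indicator without double descents. -/
noncomputable def wtd (t : R) (n : ℕ) (d : ℕ → ℕ) : R :=
  if ∀ i, d i = 0 ∨ d (i + 1) = 0 then
    t ^ (∑ i ∈ range n, d i) * (1 + t) ^ (n - 2 * ∑ i ∈ range n, d i) else 0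

theorem two_mul_sum_le (n : ℕ) (d : ℕ → ℕ) (h1 : ∀ i, d i ≤ 1) (hn : ∀ i, n ≤ i + 1 → d i = 0)
    (h : ∀ i, d i = 0 ∨ d (i + 1) = 0) : 2 * ∑ i ∈ range n, d i ≤ n := by
  induction n using Nat.strong_induction_on generalizing d with
  | _ n ih =>
  rcases n with _ | _ | n
  · simp
  · simp [hn 0]
  · by_cases h0 : d 0 = 0
    · rw [sum_range_succ', h0]
      have := ih (n + 1) (by omega) (fun i => d (i + 1)) (fun i => h1 _)
        (fun i hi => hn _ (by omega)) (fun i => h _)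
      omega
    · rw [sum_range_succ', sum_range_succ', (h 0).resolve_left h0]
      have := ih n (by omega) (fun i => d (i + 1 + 1)) (fun i => h1 _)
        (fun i hi => hn _ (by omega)) (fun i => h _)
      have := h1 0
      omega

/-- The length grows and the descent number does not. The bound `2 des ≤ n` keeps the truncated
exponent honest. -/
theorem wtd_succ_of_eq_zero (t : R) (n : ℕ) (d e : ℕ → ℕ) (h0 : d 0 = 0)
    (hs : ∀ i, d (i + 1) = e i) (h1 : ∀ i, e i ≤ 1) (hn : ∀ i, n ≤ i + 1 → e i = 0) :
    wtd t (n + 1) d = (1 + t) * wtd t n e := by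
  unfold wtd
  have hiff : (∀ i, d i = 0 ∨ d (i + 1) = 0) ↔ ∀ i, e i = 0 ∨ e (i + 1) = 0 := by
    refine ⟨fun h i => by simpa only [hs] using h (i + 1), fun h i => ?_⟩
    rcases i with _ | i
    · exact Or.inl h0
    · simpa only [hs] using h i
  by_cases h : ∀ i, e i = 0 ∨ e (i + 1) = 0
  · have hb := two_mul_sum_le n e h1 hn h
    rw [if_pos h, if_pos (hiff.2 h), sum_range_succ', h0, add_zero]
    simp only [hs]
    rw [Nat.sub_add_comm hb, pow_succ]; ring
  · rw [if_neg h, if_neg (hiff.not.2 h), mul_zero]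

theorem wtd_succ_succ_of_eq_one (t : R) (n : ℕ) (d e : ℕ → ℕ) (h0 : d 0 = 1)
    (hs : ∀ i, d (i + 1 + 1) = e i) :
    wtd t (n + 2) d = if d 1 = 0 then t * wtd t n e else 0 := by
  unfold wtd
  by_cases h : d 1 = 0
  · have hiff : (∀ i, d i = 0 ∨ d (i + 1) = 0) ↔ ∀ i, e i = 0 ∨ e (i + 1) = 0 := by
      refine ⟨fun h i => by simpa only [hs] using h (i + 1 + 1), fun h' i => ?_⟩
      rcases i with _ | _ | i
      · exact Or.inr h
      · exact Or.inl h
      · simpa only [hs] using h' i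
    rw [if_pos h]
    by_cases h' : ∀ i, e i = 0 ∨ e (i + 1) = 0
    · rw [if_pos h', if_pos (hiff.2 h'), sum_range_succ', sum_range_succ', zero_add, h0, h, add_zero]
      simp only [hs]
      rw [mul_add, mul_one, Nat.add_sub_add_right, pow_succ]; ring
    · rw [if_neg h', if_neg (hiff.not.2 h'), mul_zero]
  · rw [if_neg h, if_neg]
    intro h'
    have := h' 0
    simp [h0, h] at this

/-- The sum of `q ^ inv` over permutations without double descents, weighted by
`t ^ des * (1 + t) ^ (n - 2 des)`. -/
noncomputable def gammaSum (q t : R) (n : ℕ) : R :=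
  ∑ σ : Equiv.Perm (Fin n), q ^ QBinEul.inv σ * wtd t n (dsc σ)

/-- The part of `gammaSum` coming from permutations with first letter below `p`. -/
noncomputable def gammaSumLT (q t : R) (n p : ℕ) : R :=
  ∑ σ : Equiv.Perm (Fin n), if FirstLT σ p then q ^ QBinEul.inv σ * wtd t n (dsc σ) else 0

theorem gammaSum_sub_gammaSumLT (q t : R) (n p : ℕ) : gammaSum q t n - gammaSumLT q t n p =
    ∑ σ : Equiv.Perm (Fin n), if FirstLT σ p then 0 else q ^ QBinEul.inv σ * wtd t n (dsc σ) := by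
  unfold gammaSum gammaSumLT
  rw [← sum_sub_distrib]
  refine sum_congr rfl fun σ _ => ?_
  split_ifs <;> simp

theorem gammaSumLT_zero (q t : R) (p : ℕ) : gammaSumLT q t 0 p = 0 := by
  unfold gammaSumLT
  refine sum_eq_zero fun σ _ => if_neg ?_
  rintro ⟨h, _⟩
  omega

theorem firstLT_consPerm {n : ℕ} (a : Fin (n + 1)) (τ : Equiv.Perm (Fin n)) (p : ℕ) :
    FirstLT (consPerm a τ) p ↔ a.1 < p := by
  have : consPerm a τ ⟨0, by omega⟩ = a := consPerm_zero a τ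
  constructor
  · rintro ⟨_, h⟩; rwa [this] at h
  · intro h; exact ⟨by omega, by rwa [this]⟩

theorem sum_fin_ite_lt {M : Type*} [AddCommMonoid M] (n p : ℕ) (hp : p ≤ n) (f : ℕ → M) :
    ∑ a : Fin n, (if a.1 < p then f a else 0) = ∑ a ∈ range p, f a := by
  rw [Fin.sum_univ_eq_sum_range (fun a => if a < p then f a else 0), ← sum_filter]
  congr 1
  ext j; simp only [mem_filter, mem_range]; omega

/-- Without a descent after the first letter `a`, that letter contributes `1 + t`. With a descent,
the second letter is some `b < a` and must be followed by no descent; the two letters together then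
contribute `t`. -/
theorem sum_pow_mul_wtd_consPerm (q t : R) (n : ℕ) (a : Fin (n + 1)) :
    ∑ τ : Equiv.Perm (Fin n), q ^ QBinEul.inv τ * wtd t (n + 1) (dsc (consPerm a τ)) =
      (1 + t) * (gammaSum q t n - gammaSumLT q t n a) +
        t * ∑ b ∈ range a, q ^ b * (gammaSum q t (n - 1) - gammaSumLT q t (n - 1) b) := by
  have hs : ∀ τ : Equiv.Perm (Fin n), q ^ QBinEul.inv τ * wtd t (n + 1) (dsc (consPerm a τ)) =
      (1 + t) * (if FirstLT τ a then 0 else q ^ QBinEul.inv τ * wtd t n (dsc τ)) +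
      if FirstLT τ a then q ^ QBinEul.inv τ * wtd t (n + 1) (dsc (consPerm a τ)) else 0 := by
    intro τ
    by_cases h : FirstLT τ a
    · simp [h]
    · rw [if_neg h, if_neg h, wtd_succ_of_eq_zero t n _ (dsc τ) (by rw [dsc_consPerm_zero, if_neg h])
        (dsc_consPerm_succ a τ) (dsc_le_one τ) (fun i hi => dsc_eq_zero τ hi)]
      ring
  rw [sum_congr rfl fun τ _ => hs τ, sum_add_distrib, ← mul_sum, ← gammaSum_sub_gammaSumLT]
  congr 1
  rcases n with _ | n
  · have h0 : a.1 = 0 := by omega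
    rw [h0, range_zero, sum_empty, mul_zero]
    refine sum_eq_zero fun τ _ => if_neg ?_
    rintro ⟨h, _⟩
    omega
  · rw [Nat.add_sub_cancel, sum_perm_succ, ← sum_fin_ite_lt (n + 1) a (by omega)
      (fun b => q ^ b * (gammaSum q t n - gammaSumLT q t n b)), mul_sum]
    refine sum_congr rfl fun b _ => ?_
    simp only [firstLT_consPerm]
    split_ifs with hb
    · rw [gammaSum_sub_gammaSumLT, mul_sum, mul_sum]
      refine sum_congr rfl fun ρ _ => ?_
      rw [wtd_succ_succ_of_eq_one t n _ (dsc ρ), dsc_consPerm_succ, dsc_consPerm_zero, inv_consPerm,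
        pow_add]
      · by_cases h : FirstLT ρ b
        · simp [h]
        · simp only [h, if_false, if_true]; ring
      · rw [dsc_consPerm_zero, if_pos ((firstLT_consPerm _ _ _).2 hb)]
      · intro i; rw [dsc_consPerm_succ, dsc_consPerm_succ]
    · simp

theorem gammaSumLT_succ (q t : R) (n p : ℕ) (hp : p ≤ n + 1) :
    gammaSumLT q t (n + 1) p = ∑ a ∈ range p, q ^ a * ((1 + t) *
      (gammaSum q t n - gammaSumLT q t n a) +
        t * ∑ b ∈ range a, q ^ b * (gammaSum q t (n - 1) - gammaSumLT q t (n - 1) b)) := by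
  rw [← sum_fin_ite_lt (n + 1) p hp, gammaSumLT, sum_perm_succ]
  refine sum_congr rfl fun a _ => ?_
  simp only [firstLT_consPerm]
  split_ifs with h
  · rw [← sum_pow_mul_wtd_consPerm, mul_sum]
    refine sum_congr rfl fun τ _ => ?_
    rw [inv_consPerm, pow_add, mul_assoc]
  · simp

theorem gammaSum_zero (q t : R) : gammaSum q t 0 = 1 := by
  unfold gammaSum wtd
  have : QBinEul.inv (1 : Equiv.Perm (Fin 0)) = 0 := by rw [inv_eq]; simp
  simp [dsc, this]

/-- The recurrence that determines `gammaSum`. -/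
theorem gammaSum_recurrence (q t : R) (n : ℕ) :
    ∑ j ∈ range (n + 1), (-1) ^ j * tn t (j + 1) * es q j n * gammaSum q t (n - j) =
      if n = 0 then 1 else 0 := by
  rcases n with _ | n
  · simp [gammaSum_zero, tn, es_zero]
  · have h := bounded_sum_eq q t (gammaSum q t) (gammaSumLT q t) (gammaSumLT_zero q t)
      (gammaSumLT_succ q t) (n + 1) (n + 1) le_rfl
    have h2 : gammaSumLT q t (n + 1) (n + 1) = gammaSum q t (n + 1) := by
      unfold gammaSum gammaSumLT
      refine sum_congr rfl fun σ _ => if_pos ⟨by omega, Fin.is_lt _⟩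
    rw [h2] at h
    rw [sum_range_succ', if_neg (by omega)]
    have h3 : (-1) ^ 0 * tn t (0 + 1) * es q 0 (n + 1) * gammaSum q t (n + 1 - 0) =
        gammaSum q t (n + 1) := by simp [tn, es_zero]
    rw [h3, h, ← sum_add_distrib]
    refine sum_eq_zero fun j _ => ?_
    rw [show n + 1 - 1 - j = n + 1 - (j + 1) by omega]; ring

end Weight

end QEulerGamma

namespace QEulerGamma

open Finset

/-! ### A telescoping product of partial sums. -/

section Telescope

variable {A : Type*} [CommRing A]

/-- For consecutive elements of `S`, the factor with `≤` at one equals the factor with `<` at the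
next, so the products differ only in their end factors. The free `r` absorbs `t * x a` when the
maximum `a` is removed. -/
theorem prod_partial_sums (S : Finset ℕ) (x : ℕ → A) (t r : A) :
    (∏ k ∈ S, ((∑ l ∈ S, if l < k then x l else t * x l) + r)) * (∑ l ∈ S, x l + r) =
      (∏ k ∈ S, ((∑ l ∈ S, if l ≤ k then x l else t * x l) + r)) * (t * ∑ l ∈ S, x l + r) := by
  induction S using Finset.induction_on_max generalizing r with
  | empty => simp
  | insert a s ha ih =>
    have has : a ∉ s := fun h => (ha a h).false
    have e1 : ∑ l ∈ s, (if l < a then x l else t * x l) = ∑ l ∈ s, x l :=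
      sum_congr rfl fun l hl => if_pos (ha l hl)
    have e2 : ∑ l ∈ s, (if l ≤ a then x l else t * x l) = ∑ l ∈ s, x l :=
      sum_congr rfl fun l hl => if_pos (ha l hl).le
    have e3 : ∀ k ∈ s, (∑ l ∈ insert a s, if l < k then x l else t * x l) + r =
        (∑ l ∈ s, if l < k then x l else t * x l) + (t * x a + r) := by
      intro k hk
      rw [sum_insert has, if_neg (ha k hk).not_gt]; ring
    have e4 : ∀ k ∈ s, (∑ l ∈ insert a s, if l ≤ k then x l else t * x l) + r =
        (∑ l ∈ s, if l ≤ k then x l else t * x l) + (t * x a + r) := by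
      intro k hk
      rw [sum_insert has, if_neg (ha k hk).not_ge]; ring
    rw [prod_insert has, prod_insert has, prod_congr rfl e3, prod_congr rfl e4, sum_insert has,
      sum_insert has, sum_insert has, if_neg (lt_irrefl a), if_pos le_rfl, e1, e2]
    linear_combination (x a + ∑ l ∈ s, x l + r) * ih (t * x a + r)

end Telescope

/-! ### Coefficients of products of linear forms, plain and marked. -/

section Words

open MvPolynomial

variable {R : Type*} [CommRing R]

/-- The linear form `t ∑_{l ≥ k} X_l + ∑_{l ≤ k} X_l` over the alphabet `A`. -/
noncomputable def lin (t : R) (A : Finset ℕ) (k : ℕ) : MvPolynomial ℕ R :=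
  ∑ l ∈ A, ((if k ≤ l then C t else 0) + (if l ≤ k then 1 else 0)) * X l

theorem lin_sub_X (t : R) (S : Finset ℕ) {k : ℕ} (hk : k ∈ S) :
    lin t S k - X k = ∑ l ∈ S, if l < k then X l else C t * X l := by
  have h : (X k : MvPolynomial ℕ R) = ∑ l ∈ S, if l = k then X l else 0 := by
    rw [sum_ite_eq' S k, if_pos hk]
  rw [h, lin, ← sum_sub_distrib]
  refine sum_congr rfl fun l _ => ?_
  rcases lt_trichotomy l k with h | h | h
  · simp [h, h.le, h.not_ge, h.ne]
  · subst h; simp; ring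
  · simp [h.le, h.not_ge, h.not_gt, h.ne']

theorem lin_sub_mul_X (t : R) (S : Finset ℕ) {k : ℕ} (hk : k ∈ S) :
    lin t S k - C t * X k = ∑ l ∈ S, if l ≤ k then X l else C t * X l := by
  have h : (C t * X k : MvPolynomial ℕ R) = ∑ l ∈ S, if l = k then C t * X l else 0 := by
    rw [sum_ite_eq' S k, if_pos hk]
  rw [h, lin, ← sum_sub_distrib]
  refine sum_congr rfl fun l _ => ?_
  rcases lt_trichotomy l k with h | h | h
  · simp [h.le, h.not_ge, h.ne]
  · subst h; simp; ring
  · simp [h.le, h.not_ge, h.ne']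

theorem prod_lin_sub [IsDomain R] (t : R) {S : Finset ℕ} (hS : S.Nonempty) :
    ∏ k ∈ S, (lin t S k - X k) = C t * ∏ k ∈ S, (lin t S k - C t * X k) := by
  have hne : (∑ l ∈ S, X l : MvPolynomial ℕ R) ≠ 0 := by
    obtain ⟨a, ha⟩ := hS
    intro h
    have := congrArg (coeff (Finsupp.single a 1)) h
    rw [coeff_sum, coeff_zero, sum_eq_single a] at this
    · simp at this
    · intro b _ hb
      rw [coeff_X, if_neg]
      intro h
      exact hb (Finsupp.single_left_injective one_ne_zero h)
    · exact fun h => (h ha).elim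
  have h := prod_partial_sums S (X : ℕ → MvPolynomial ℕ R) (C t) 0
  simp only [add_zero] at h
  rw [prod_congr rfl fun k hk => lin_sub_X t S hk, prod_congr rfl fun k hk => lin_sub_mul_X t S hk]
  refine mul_right_cancel₀ hne ?_
  rw [h]; ring

/-- The substitution that sends the variables outside `S` to `0`. -/
noncomputable def kill (S : Finset ℕ) : MvPolynomial ℕ R →ₐ[R] MvPolynomial ℕ R :=
  aeval fun l => if l ∈ S then X l else 0

@[simp] theorem kill_C (S : Finset ℕ) (r : R) : kill S (C r) = C r := by
  simp [kill]

theorem kill_X (S : Finset ℕ) (l : ℕ) :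
    kill S (X l : MvPolynomial ℕ R) = if l ∈ S then X l else 0 := by
  simp [kill]

/-- This allows restriction to the letters that occur in `c`; block positions, and the telescoping
over the support, behave only for those. -/
theorem coeff_kill {S : Finset ℕ} {c : ℕ →₀ ℕ} (hc : c.support ⊆ S) (p : MvPolynomial ℕ R) :
    coeff c (kill S p) = coeff c p := by
  induction p using MvPolynomial.induction_on' with
  | add p q hp hq => simp [hp, hq]
  | monomial m r =>
    by_cases hm : m.support ⊆ S
    · congr 1
      rw [kill, aeval_monomial, monomial_eq, algebraMap_eq]
      congr 1
      refine Finsupp.prod_congr fun l hl => ?_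
      rw [if_pos (hm hl)]
    · obtain ⟨l, hl, hlS⟩ := not_subset.1 hm
      have h0 : kill S (monomial m r) = 0 := by
        rw [kill, aeval_monomial, Finsupp.prod, prod_eq_zero hl, mul_zero]
        rw [if_neg hlS, zero_pow (Finsupp.mem_support_iff.1 hl)]
      rw [h0, coeff_zero, coeff_monomial, if_neg]
      rintro rfl
      exact hlS (hc hl)

theorem kill_sum_mul_X (S A : Finset ℕ) (hSA : S ⊆ A) (f : ℕ → MvPolynomial ℕ R)
    (hf : ∀ l, kill S (f l) = f l) :
    kill S (∑ l ∈ A, f l * X l) = ∑ l ∈ S, f l * X l := by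
  rw [map_sum]
  simp only [map_mul, hf, kill_X, mul_ite, mul_zero]
  rw [← sum_filter, filter_mem_eq_inter, inter_eq_right.2 hSA]

theorem kill_lin (t : R) {S A : Finset ℕ} (hSA : S ⊆ A) (k : ℕ) :
    kill S (lin t A k) = lin t S k := by
  unfold lin
  rw [kill_sum_mul_X S A hSA]
  intro l
  rw [map_add]
  split_ifs <;> simp

/-- The multiset of the entries of a word, as a finitely supported function. -/
noncomputable def content {n : ℕ} (w : Fin n → ℕ) : ℕ →₀ ℕ := ∑ j, Finsupp.single (w j) 1

theorem coeff_prod_sum {n : ℕ} (A : Finset ℕ) (F : Fin n → ℕ → R) (κ : ℕ → ℕ) (c : ℕ →₀ ℕ) :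
    coeff c (∏ j, ∑ a ∈ A, C (F j a) * X (κ a)) =
      ∑ ω ∈ Fintype.piFinset (fun _ : Fin n => A) with content (fun j => κ (ω j)) = c,
        ∏ j, F j (ω j) := by
  rw [prod_univ_sum, coeff_sum, sum_filter]
  refine sum_congr rfl fun ω _ => ?_
  have : ∏ j, (C (F j (ω j)) * X (κ (ω j)) : MvPolynomial ℕ R) =
      monomial (content fun j => κ (ω j)) (∏ j, F j (ω j)) := by
    rw [content, ← one_mul (∏ j, F j (ω j)), prod_mul_distrib, ← map_prod, mul_comm 1,
      ← C_mul_monomial, monomial_sum_one]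
    rfl
  rw [this, coeff_monomial]

/-- The number of letters `≥ m` in a word of content `c`. -/
def tailCount (N : ℕ) (c : ℕ →₀ ℕ) (m : ℕ) : ℕ := ∑ l ∈ Ico m N, c l

theorem tailCount_eq_add (N : ℕ) (c : ℕ →₀ ℕ) {m : ℕ} (hm : m < N) :
    tailCount N c m = c m + tailCount N c (m + 1) :=
  sum_eq_sum_Ico_succ_bot hm _

theorem tailCount_antitone (N : ℕ) (c : ℕ →₀ ℕ) : Antitone (tailCount N c) :=
  fun _ _ h => sum_le_sum_of_subset (Ico_subset_Ico_left h)

theorem prod_range_blocks {M : Type*} [CommMonoid M] (N : ℕ) (c : ℕ →₀ ℕ) (f : ℕ → M) :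
    ∏ k ∈ range N, ∏ j ∈ Ico (tailCount N c (k + 1)) (tailCount N c k), f j =
      ∏ j ∈ range (tailCount N c 0), f j := by
  have key : ∀ m, ∏ k ∈ range m, ∏ j ∈ Ico (tailCount N c (k + 1)) (tailCount N c k), f j =
      ∏ j ∈ Ico (tailCount N c m) (tailCount N c 0), f j := by
    intro m
    induction m with
    | zero => simp
    | succ m ih =>
      rw [prod_range_succ, ih, mul_comm,
        prod_Ico_consecutive _ (tailCount_antitone N c (Nat.le_succ m))
          (tailCount_antitone N c (Nat.zero_le m))]
  rw [key, show tailCount N c N = 0 by simp [tailCount], range_eq_Ico]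

/-- The weight of the coded letter `a` at position `j` of a word of content `c`: an odd letter `2k+1`
has weight `t` and must stand after the first position of the block of `k`; an even letter `2k` has
weight `1` and must not stand after that block. -/
def locWt (t : R) (N : ℕ) (c : ℕ →₀ ℕ) (j a : ℕ) : R :=
  if a % 2 = 1 then (if tailCount N c (a / 2 + 1) < j then t else 0)
  else (if j < tailCount N c (a / 2) then 1 else 0)

theorem sum_range_two_mul' {M : Type*} [AddCommMonoid M] (N : ℕ) (f : ℕ → M) :
    ∑ a ∈ range (2 * N), f a = ∑ l ∈ range N, (f (2 * l + 1) + f (2 * l)) := by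
  induction N with
  | zero => simp
  | succ N ih =>
    rw [show 2 * (N + 1) = 2 * N + 1 + 1 by ring, sum_range_succ, sum_range_succ, sum_range_succ, ih,
      add_assoc, add_comm (f (2 * N))]

theorem sum_locWt (t : R) (N : ℕ) (c : ℕ →₀ ℕ) (j : ℕ) :
    ∑ a ∈ range (2 * N), (C (locWt t N c j a) * X (a / 2) : MvPolynomial ℕ R) =
      ∑ l ∈ range N, (C (if tailCount N c (l + 1) < j then t else 0) +
        C (if j < tailCount N c l then 1 else 0)) * X l := by
  rw [sum_range_two_mul']
  refine sum_congr rfl fun l _ => ?_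
  unfold locWt
  rw [if_pos (show (2 * l + 1) % 2 = 1 by omega), if_neg (show ¬ 2 * l % 2 = 1 by omega),
    show (2 * l + 1) / 2 = l by omega, show 2 * l / 2 = l by omega, add_mul]

/-- At a position `j` in the block of `k`, an occurring letter `l > k` has its block before `j` and
may only be odd (weight `t`), and `l < k` may only be even (weight `1`). The letter `k` may be both,
except that the start of the block excludes the odd form. -/
theorem kill_sum_locWt (t : R) {N : ℕ} {c : ℕ →₀ ℕ} (hc : c.support ⊆ range N) {k j : ℕ}
    (hk : k < N) (hj : j ∈ Ico (tailCount N c (k + 1)) (tailCount N c k)) :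
    kill c.support (∑ a ∈ range (2 * N), (C (locWt t N c j a) * X (a / 2) : MvPolynomial ℕ R)) =
      lin t c.support k - if j = tailCount N c (k + 1) then C t * X k else 0 := by
  have hj := mem_Ico.1 hj
  have hkS : k ∈ c.support := by
    rw [Finsupp.mem_support_iff]
    have := tailCount_eq_add N c hk
    omega
  rw [sum_locWt, kill_sum_mul_X _ _ hc _ (fun l => by simp)]
  have h : (if j = tailCount N c (k + 1) then C t * X k else 0 : MvPolynomial ℕ R) =
      ∑ l ∈ c.support, if l = k then (if j = tailCount N c (k + 1) then C t else 0) * X l else 0 := by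
    rw [sum_ite_eq' _ k, if_pos hkS]
    split_ifs <;> simp
  rw [h, lin, ← sum_sub_distrib]
  refine sum_congr rfl fun l hl => ?_
  have hlN := mem_range.1 (hc hl)
  have hl0 := Finsupp.mem_support_iff.1 hl
  have e := tailCount_eq_add N c hlN
  rcases lt_trichotomy l k with h | h | h
  · have := tailCount_antitone N c (show l + 1 ≤ k by omega)
    rw [if_neg (by omega), if_pos (by omega), if_neg h.not_ge, if_pos h.le, if_neg h.ne]
    simp
  · subst h
    rw [if_pos hj.2, if_pos le_rfl, if_pos rfl]
    by_cases h' : j = tailCount N c (l + 1)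
    · rw [if_neg (by omega), if_pos h']; simp; ring
    · rw [if_pos (by omega), if_neg h']; simp
  · have := tailCount_antitone N c (show k + 1 ≤ l by omega)
    rw [if_pos (by omega), if_neg (by omega), if_pos h.le, if_neg h.not_ge, if_neg h.ne']
    simp

/-- The coefficient of `X ^ c` in `∏ L_k ^ (c_k - 1) * (L_k - τ X_k)` over the support of `c`. -/
noncomputable def markedCoeff (t τ : R) (N : ℕ) (c : ℕ →₀ ℕ) : R :=
  coeff c (∏ k ∈ c.support, lin t (range N) k ^ (c k - 1) * (lin t (range N) k - C τ * X k))

/-- Group the positions by blocks: the first position of block `k` contributes `L_k - t X_k`, the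
other `c_k - 1` contribute `L_k`. -/
theorem coeff_prod_locWt (t : R) {n N : ℕ} {c : ℕ →₀ ℕ} (hc : c ∈ finsuppAntidiag (range N) n) :
    coeff c (∏ j : Fin n, ∑ a ∈ range (2 * N), (C (locWt t N c j a) * X (a / 2))) =
      markedCoeff t t N c := by
  obtain ⟨hn, hc⟩ := mem_finsuppAntidiag.1 hc
  have hn : tailCount N c 0 = n := by rw [← hn, tailCount, range_eq_Ico]
  unfold markedCoeff
  rw [← coeff_kill (subset_refl c.support), ← coeff_kill (subset_refl c.support) (∏ k ∈ c.support, _),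
    map_prod, map_prod]
  congr 1
  rw [Fin.prod_univ_eq_prod_range (fun j => kill c.support
    (∑ a ∈ range (2 * N), (C (locWt t N c j a) * X (a / 2)))) n, ← hn, ← prod_range_blocks,
    ← prod_subset hc]
  · refine prod_congr rfl fun k hk => ?_
    have hkN := mem_range.1 (hc hk)
    have e := tailCount_eq_add N c hkN
    have h0 := Finsupp.mem_support_iff.1 hk
    rw [prod_congr rfl fun j hj => kill_sum_locWt t hc hkN hj,
      prod_eq_prod_Ico_succ_bot (by omega), if_pos rfl, map_mul, map_pow, map_sub, map_mul, kill_C,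
      kill_X, if_pos hk, kill_lin t hc, mul_comm]
    congr 1
    rw [prod_congr rfl (g := fun _ => lin t c.support k), prod_const, Nat.card_Ico]
    · congr 1; omega
    · intro j hj
      have := mem_Ico.1 hj
      rw [if_neg (by omega), sub_zero]
  · intro k hk hk'
    have e := tailCount_eq_add N c (mem_range.1 hk)
    rw [Finsupp.notMem_support_iff.1 hk', zero_add] at e
    rw [e, Ico_self, prod_empty]

theorem markedCoeff_one [IsDomain R] (t : R) {N : ℕ} {c : ℕ →₀ ℕ} (hc : c.support ⊆ range N)
    (h0 : c ≠ 0) : markedCoeff t 1 N c = t * markedCoeff t t N c := by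
  unfold markedCoeff
  rw [← coeff_C_mul, ← coeff_kill (subset_refl c.support),
    ← coeff_kill (subset_refl c.support) (C t * _), map_mul, kill_C, map_prod, map_prod]
  congr 1
  have e : ∀ τ : R, ∏ k ∈ c.support, kill c.support
      (lin t (range N) k ^ (c k - 1) * (lin t (range N) k - C τ * X k)) =
      (∏ k ∈ c.support, lin t c.support k ^ (c k - 1)) *
        ∏ k ∈ c.support, (lin t c.support k - C τ * X k) := by
    intro τ
    rw [← prod_mul_distrib]
    refine prod_congr rfl fun k hk => ?_
    rw [map_mul, map_pow, map_sub, map_mul, kill_C, kill_X, if_pos hk, kill_lin t hc]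
  rw [e, e]
  simp only [C_1, one_mul]
  rw [prod_lin_sub t (Finsupp.support_nonempty_iff.2 h0)]
  ring

/-- The coefficient of `X ^ c` in `∏ L_k ^ c_k`. -/
noncomputable def plainCoeff (t : R) (N : ℕ) (c : ℕ →₀ ℕ) : R :=
  coeff c (∏ k ∈ range N, lin t (range N) k ^ c k)

/-- The indicator function of a finite set. -/
noncomputable def ind (J : Finset ℕ) : ℕ →₀ ℕ := ∑ k ∈ J, Finsupp.single k 1

theorem ind_apply (J : Finset ℕ) (k : ℕ) : ind J k = if k ∈ J then 1 else 0 := by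
  rw [ind, Finsupp.finsetSum_apply]
  simp [Finsupp.single_apply]

theorem ind_le {J : Finset ℕ} {c : ℕ →₀ ℕ} (hJ : J ⊆ c.support) : ind J ≤ c := by
  intro k
  rw [ind_apply]
  split_ifs with h
  · exact Nat.one_le_iff_ne_zero.2 (Finsupp.mem_support_iff.1 (hJ h))
  · exact Nat.zero_le _

/-- Expand the product; `J` is the set of `k` at which the term `-τ X_k` is chosen. -/
theorem markedCoeff_eq_sum (t τ : R) {N : ℕ} {c : ℕ →₀ ℕ} (hc : c.support ⊆ range N) :
    markedCoeff t τ N c =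
      ∑ J ∈ c.support.powerset, (-τ) ^ #J * plainCoeff t N (c - ind J) := by
  unfold markedCoeff
  have e : ∀ k ∈ c.support, lin t (range N) k ^ (c k - 1) * (lin t (range N) k - C τ * X k) =
      C (-τ) * X k * lin t (range N) k ^ (c k - 1) + lin t (range N) k ^ c k := by
    intro k hk
    have := Finsupp.mem_support_iff.1 hk
    obtain ⟨m, hm⟩ := Nat.exists_eq_succ_of_ne_zero this
    rw [hm, Nat.succ_sub_one, C_neg, pow_succ]; ring
  rw [prod_congr rfl e, prod_add, coeff_sum]
  refine sum_congr rfl fun J hJ => ?_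
  have hJ := mem_powerset.1 hJ
  have e2 : (∏ k ∈ J, C (-τ) * X k * lin t (range N) k ^ (c k - 1)) *
      ∏ k ∈ c.support \ J, lin t (range N) k ^ c k =
      monomial (ind J) ((-τ) ^ #J) * ∏ k ∈ range N, lin t (range N) k ^ (c - ind J) k := by
    have e3 : (monomial (ind J) ((-τ) ^ #J) : MvPolynomial ℕ R) = ∏ k ∈ J, C (-τ) * X k := by
      rw [prod_mul_distrib, prod_const, ind, ← mul_one ((-τ) ^ #J), ← C_mul_monomial,
        monomial_sum_one, map_pow]
      rfl
    rw [e3, prod_mul_distrib (s := J), mul_assoc]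
    congr 1
    rw [← prod_subset hc, ← prod_sdiff hJ, mul_comm]
    · congr 1
      · refine prod_congr rfl fun k hk => ?_
        rw [Finsupp.tsub_apply, ind_apply, if_neg (mem_sdiff.1 hk).2, Nat.sub_zero]
      · refine prod_congr rfl fun k hk => ?_
        rw [Finsupp.tsub_apply, ind_apply, if_pos hk]
    · intro k _ hk
      rw [Finsupp.tsub_apply, Finsupp.notMem_support_iff.1 hk, Nat.zero_sub, pow_zero]
  rw [e2]
  unfold plainCoeff
  conv_lhs => rw [← add_tsub_cancel_of_le (ind_le hJ)]
  rw [coeff_monomial_mul, add_tsub_cancel_of_le (ind_le hJ)]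

/-- The sum `∑ k c_k`. -/
def totalWt (N : ℕ) (c : ℕ →₀ ℕ) : ℕ := ∑ k ∈ range N, k * c k

/-- The sum of `plainCoeff` over contents of size `n`, specialised at `1, q, q ^ 2, …`. -/
noncomputable def plainSum (q t : R) (N n : ℕ) : R :=
  ∑ c ∈ finsuppAntidiag (range N) n, q ^ totalWt N c * plainCoeff t N c

/-- The sum of `markedCoeff` over contents of size `n`, specialised at `1, q, q ^ 2, …`. -/
noncomputable def markedSum (q t τ : R) (N n : ℕ) : R :=
  ∑ c ∈ finsuppAntidiag (range N) n, q ^ totalWt N c * markedCoeff t τ N c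

theorem sum_ind {J : Finset ℕ} {N : ℕ} (hJ : J ⊆ range N) : ∑ k ∈ range N, ind J k = #J := by
  simp only [ind_apply]
  rw [← sum_filter, filter_mem_eq_inter, inter_eq_right.2 hJ]; simp

theorem totalWt_ind {J : Finset ℕ} {N : ℕ} (hJ : J ⊆ range N) : totalWt N (ind J) = ∑ k ∈ J, k := by
  simp only [totalWt, ind_apply, mul_ite, mul_one, mul_zero]
  rw [← sum_filter, filter_mem_eq_inter, inter_eq_right.2 hJ]

/-- Shift `c` by the indicator of `J`. Summed over all `J` of size `j`, the factor `∏ q^k` becomes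
`e_j(N)`. -/
theorem sum_content_of_subset (q t : R) {N n : ℕ} {J : Finset ℕ} (hJ : J ⊆ range N) :
    ∑ c ∈ finsuppAntidiag (range N) n with J ⊆ c.support,
      q ^ totalWt N c * plainCoeff t N (c - ind J) =
    if #J ≤ n then (∏ k ∈ J, q ^ k) * plainSum q t N (n - #J) else 0 := by
  have hle : ∀ c ∈ finsuppAntidiag (range N) n, J ⊆ c.support →
      ∑ k ∈ range N, (c - ind J) k + #J = n := by
    intro c hc h
    rw [← (mem_finsuppAntidiag.1 hc).1, ← sum_ind hJ, ← sum_add_distrib]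
    refine sum_congr rfl fun k _ => ?_
    rw [Finsupp.tsub_apply, Nat.sub_add_cancel (ind_le h k)]
  split_ifs with hn
  · rw [plainSum, mul_sum]
    refine sum_nbij' (fun c => c - ind J) (fun c => c + ind J) ?_ ?_ ?_ ?_ ?_
    · intro c hc
      obtain ⟨hc, h⟩ := mem_filter.1 hc
      have := hle c hc h
      refine mem_finsuppAntidiag.2 ⟨by change ∑ k ∈ range N, (c - ind J) k = _; omega, ?_⟩
      exact (Finsupp.support_mono tsub_le_self).trans (mem_finsuppAntidiag.1 hc).2
    · intro c hc
      obtain ⟨hc, h⟩ := mem_finsuppAntidiag.1 hc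
      have hs : J ⊆ (c + ind J).support := by
        intro k hk
        rw [Finsupp.mem_support_iff, Finsupp.add_apply, ind_apply, if_pos hk]; omega
      refine mem_filter.2 ⟨mem_finsuppAntidiag.2 ⟨?_, ?_⟩, hs⟩
      · change ∑ k ∈ range N, (c + ind J) k = n
        simp only [Finsupp.add_apply]
        rw [sum_add_distrib, sum_ind hJ]
        change ∑ k ∈ range N, c k = n - #J at hc
        omega
      · intro k hk
        rw [Finsupp.mem_support_iff, Finsupp.add_apply, ind_apply] at hk
        by_cases hkJ : k ∈ J
        · exact hJ hkJ
        · rw [if_neg hkJ, add_zero] at hk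
          exact h (Finsupp.mem_support_iff.2 hk)
    · intro c hc
      exact tsub_add_cancel_of_le (ind_le (mem_filter.1 hc).2)
    · intro c _
      exact add_tsub_cancel_right _ _
    · intro c hc
      obtain ⟨hc, h⟩ := mem_filter.1 hc
      have : totalWt N c = ∑ k ∈ J, k + totalWt N (c - ind J) := by
        rw [← totalWt_ind hJ, totalWt, totalWt, totalWt, ← sum_add_distrib]
        refine sum_congr rfl fun k _ => ?_
        rw [← mul_add, Finsupp.tsub_apply, Nat.add_sub_cancel' (ind_le h k)]
      rw [this, pow_add, prod_pow_eq_pow_sum, mul_assoc]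
  · refine sum_eq_zero fun c hc => ?_
    obtain ⟨hc, h⟩ := mem_filter.1 hc
    have := hle c hc h
    omega

theorem markedSum_eq (q t τ : R) (N n : ℕ) :
    markedSum q t τ N n = ∑ j ∈ range (n + 1), (-τ) ^ j * es q j N * plainSum q t N (n - j) := by
  have h1 : markedSum q t τ N n = ∑ J ∈ (range N).powerset, (-τ) ^ #J *
      ∑ c ∈ finsuppAntidiag (range N) n with J ⊆ c.support,
        q ^ totalWt N c * plainCoeff t N (c - ind J) := by
    simp only [mul_sum]
    rw [markedSum, sum_comm' (t' := finsuppAntidiag (range N) n) (s' := fun c => c.support.powerset)]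
    · refine sum_congr rfl fun c hc => ?_
      rw [markedCoeff_eq_sum t τ (mem_finsuppAntidiag.1 hc).2, mul_sum]
      refine sum_congr rfl fun J _ => by ring
    · intro J c
      simp only [mem_powerset, mem_filter]
      constructor
      · rintro ⟨_, h, h'⟩; exact ⟨h', h⟩
      · rintro ⟨h, h'⟩; exact ⟨h.trans (mem_finsuppAntidiag.1 h').2, h', h⟩
  rw [h1, sum_congr rfl fun J hJ => by rw [sum_content_of_subset q t (mem_powerset.1 hJ), mul_ite,
    mul_zero], ← sum_filter, ← sum_fiberwise_of_maps_to (g := card) (t := range (n + 1))]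
  · refine sum_congr rfl fun j hj => ?_
    have hj := mem_range.1 hj
    rw [es_eq_sum_powersetCard, mul_assoc, sum_mul, mul_sum]
    refine sum_congr ?_ fun J hJ => ?_
    · ext J
      simp only [mem_filter, mem_powerset, mem_powersetCard]
      constructor
      · rintro ⟨⟨h1, _⟩, h2⟩; exact ⟨h1, h2⟩
      · rintro ⟨h1, h2⟩; exact ⟨⟨h1, by omega⟩, h2⟩
    · rw [(mem_powersetCard.1 hJ).2]
  · intro J hJ
    have := (mem_filter.1 hJ).2
    exact mem_range.2 (by omega)

/-- For `n = 0` the only content is `0`, with value `1` for both markings; this causes the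
correction `1 - t`. -/
theorem markedSum_one [IsDomain R] (q t : R) (N n : ℕ) :
    markedSum q t 1 N n = (if n = 0 then 1 - t else 0) + t * markedSum q t t N n := by
  rcases n with _ | n
  · have h : finsuppAntidiag (range N) 0 = {(0 : ℕ →₀ ℕ)} := by simp
    unfold markedSum
    rw [h, sum_singleton, sum_singleton]
    simp [totalWt, markedCoeff]
  · rw [if_neg (by omega), zero_add, markedSum, markedSum, mul_sum]
    refine sum_congr rfl fun c hc => ?_
    obtain ⟨h1, h2⟩ := mem_finsuppAntidiag.1 hc
    rw [markedCoeff_one t h2]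
    · ring
    · rintro rfl; simp at h1

end Words

end QEulerGamma

namespace QEulerGamma

open Finset QBinEul

/-! ### Contents of words. -/

section Content

variable {n : ℕ}

theorem content_apply (w : Fin n → ℕ) (k : ℕ) :
    content w k = ∑ j, if w j = k then 1 else 0 := by
  rw [content, Finsupp.finsetSum_apply]
  simp [Finsupp.single_apply]

theorem totalWt_content {w : Fin n → ℕ} {N : ℕ} (hw : ∀ j, w j < N) :
    totalWt N (content w) = ∑ j, w j := by
  simp only [totalWt, content_apply, mul_sum]
  rw [sum_comm]
  refine sum_congr rfl fun j _ => ?_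
  simp only [mul_ite, mul_one, mul_zero]
  rw [sum_ite_eq, if_pos (mem_range.2 (hw j))]

theorem tailCount_content {w : Fin n → ℕ} {N : ℕ} (hw : ∀ j, w j < N) (m : ℕ) :
    tailCount N (content w) m = #{j | m ≤ w j} := by
  simp only [tailCount, content_apply]
  rw [sum_comm, card_filter]
  refine sum_congr rfl fun j _ => ?_
  rw [sum_ite_eq]
  refine if_congr ?_ rfl rfl
  simp [hw j]

theorem content_mem_finsuppAntidiag {w : Fin n → ℕ} {N : ℕ} (hw : ∀ j, w j < N) :
    content w ∈ finsuppAntidiag (range N) n := by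
  refine mem_finsuppAntidiag.2 ⟨?_, ?_⟩
  · change ∑ k ∈ range N, content w k = n
    simp only [content_apply]
    rw [sum_comm]
    simp [hw]
  · intro k hk
    rw [Finsupp.mem_support_iff, content_apply] at hk
    obtain ⟨j, _, hj⟩ := exists_ne_zero_of_sum_ne_zero hk
    have : w j = k := by by_contra h; simp [h] at hj
    rw [← this]; exact mem_range.2 (hw j)

end Content

/-! ### Stable sorting, and admissibility in terms of excedances. -/

section Sorting

variable {n : ℕ}

/-- `σ` is the stable sort of `ω` in weakly decreasing order. -/
def Sorts (σ : Equiv.Perm (Fin n)) (ω : Fin n → ℕ) : Prop :=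
  (∀ i j, i ≤ j → ω (σ j) ≤ ω (σ i)) ∧ ∀ i j, i < j → ω (σ i) = ω (σ j) → σ i < σ j

/-- The permutation that stably sorts `ω` in weakly decreasing order. -/
noncomputable def sortPerm (ω : Fin n → ℕ) : Equiv.Perm (Fin n) :=
  Tuple.sort fun j => OrderDual.toDual (ω j)

theorem sortPerm_eq_iff (σ : Equiv.Perm (Fin n)) (ω : Fin n → ℕ) :
    sortPerm ω = σ ↔ Sorts σ ω := by
  rw [eq_comm, sortPerm, Tuple.eq_sort_iff]
  exact Iff.rfl

theorem sorts_of_adjacent {σ : Equiv.Perm (Fin n)} {ω : Fin n → ℕ}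
    (h : ∀ (i : ℕ) (hi : i + 1 < n), ω (σ ⟨i + 1, hi⟩) ≤ ω (σ ⟨i, by omega⟩) ∧
      (ω (σ ⟨i, by omega⟩) = ω (σ ⟨i + 1, hi⟩) → σ ⟨i, by omega⟩ < σ ⟨i + 1, hi⟩)) :
    Sorts σ ω := by
  have key : ∀ (d i : ℕ) (hi : i + d + 1 < n), ω (σ ⟨i + d + 1, hi⟩) ≤ ω (σ ⟨i, by omega⟩) ∧
      (ω (σ ⟨i, by omega⟩) = ω (σ ⟨i + d + 1, hi⟩) → σ ⟨i, by omega⟩ < σ ⟨i + d + 1, hi⟩) := by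
    intro d
    induction d with
    | zero => intro i hi; exact h i hi
    | succ d ih =>
      intro i hi
      obtain ⟨h1, h2⟩ := ih i (by omega)
      obtain ⟨h3, h4⟩ := h (i + d + 1) hi
      refine ⟨h3.trans h1, fun e => ?_⟩
      have e1 : ω (σ ⟨i, by omega⟩) = ω (σ ⟨i + d + 1, by omega⟩) :=
        le_antisymm (e.trans_le h3) h1
      exact (h2 e1).trans (h4 (e1.symm.trans e))
  have key2 : ∀ i j : Fin n, i < j → ω (σ j) ≤ ω (σ i) ∧ (ω (σ i) = ω (σ j) → σ i < σ j) := by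
    intro i j hij
    have hij : i.1 < j.1 := hij
    obtain ⟨d, hd⟩ := Nat.exists_eq_add_of_lt hij
    have hj : j = ⟨i.1 + d + 1, by omega⟩ := Fin.ext hd
    rw [hj]
    exact key d i.1 (by omega)
  refine ⟨fun i j hij => ?_, fun i j hij => (key2 i j hij).2⟩
  rcases hij.eq_or_lt with rfl | hij
  · exact le_rfl
  · exact (key2 i j hij).1

/-- Odd letters stand strictly after the start of their block in the sorted word, and even letters
do not stand after the end of their block. -/
def Admissible (ω : Fin n → ℕ) : Prop :=
  ∀ j : Fin n, (ω j % 2 = 1 → #{i | ω j < ω i} < j.1) ∧ (ω j % 2 = 0 → j.1 < #{i | ω j ≤ ω i})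

theorem card_filter_perm (σ : Equiv.Perm (Fin n)) (p : Fin n → Prop) [DecidablePred p] :
    #{i | p i} = #{i | p (σ i)} := by
  rw [card_filter, card_filter, ← Equiv.sum_comp σ]

/-- On a block of equal coded letters `σ` is increasing, so `k < σ k` propagates to the right and `σ
k ≤ k` to the left. Hence an odd block consists of excedances as soon as its first index is one, and
an even block contains none as soon as its last index is not one. Admissibility at these end indices
is exactly that condition. -/
theorem admissible_iff {σ : Equiv.Perm (Fin n)} {ω : Fin n → ℕ} (h : Sorts σ ω) :
    Admissible ω ↔ ∀ i, ω (σ i) % 2 = 1 ↔ i < σ i := by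
  obtain ⟨h1, h2⟩ := h
  -- the start and the end of the block of an index
  have hstart : ∀ i : Fin n, ∃ i0 ≤ i, ω (σ i0) = ω (σ i) ∧ #{k | ω (σ i) < ω k} = i0.1 := by
    intro i
    have hne : (univ.filter fun k => ω (σ k) = ω (σ i)).Nonempty := ⟨i, by simp⟩
    refine ⟨_, min'_le _ i (by simp), (mem_filter.1 (min'_mem _ hne)).2, ?_⟩
    set i0 := (univ.filter fun k => ω (σ k) = ω (σ i)).min' hne with hi0
    have hv : ω (σ i0) = ω (σ i) := (mem_filter.1 (min'_mem _ hne)).2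
    rw [card_filter_perm σ, show (univ.filter fun k => ω (σ i) < ω (σ k)) = Iio i0 from ?_, Fin.card_Iio]
    ext k
    simp only [mem_filter, mem_univ, true_and, mem_Iio]
    constructor
    · intro hk
      by_contra hc
      have := h1 i0 k (not_lt.1 hc)
      omega
    · intro hk
      have hle := h1 k i0 hk.le
      rcases eq_or_ne (ω (σ k)) (ω (σ i)) with e | e
      · exact absurd (min'_le _ k (by simpa using e)) (not_le.2 hk)
      · omega
  have hend : ∀ i : Fin n, ∃ i1 ≥ i, ω (σ i1) = ω (σ i) ∧ #{k | ω (σ i) ≤ ω k} = i1.1 + 1 := by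
    intro i
    have hne : (univ.filter fun k => ω (σ k) = ω (σ i)).Nonempty := ⟨i, by simp⟩
    refine ⟨_, le_max' _ i (by simp), (mem_filter.1 (max'_mem _ hne)).2, ?_⟩
    set i1 := (univ.filter fun k => ω (σ k) = ω (σ i)).max' hne with hi1
    have hv : ω (σ i1) = ω (σ i) := (mem_filter.1 (max'_mem _ hne)).2
    rw [card_filter_perm σ, show (univ.filter fun k => ω (σ i) ≤ ω (σ k)) = Iic i1 from ?_, Fin.card_Iic]
    ext k
    simp only [mem_filter, mem_univ, true_and, mem_Iic]
    constructor
    · intro hk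
      by_contra hc
      have hle := h1 i1 k (not_le.1 hc).le
      exact hc (le_max' _ k (by simp; omega))
    · intro hk
      have hle := h1 k i1 hk
      omega
  constructor
  · intro hA
    have hodd : ∀ i, ω (σ i) % 2 = 1 → i < σ i := by
      intro i hi
      obtain ⟨i0, hi0, hv, hc⟩ := hstart i
      have key : ∀ (k : ℕ) (hk : k < n), i0.1 ≤ k → k ≤ i.1 → k < (σ ⟨k, hk⟩).1 := by
        intro k hk hle
        induction k, hle using Nat.le_induction with
        | base =>
          intro _
          have := (hA (σ i0)).1 (by rw [hv]; exact hi)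
          rwa [hv, hc] at this
        | succ k hle ih =>
          intro hki
          have hk' := ih (by omega) (by omega)
          have a1 := h1 i0 ⟨k, by omega⟩ hle
          have a2 := h1 ⟨k, by omega⟩ ⟨k + 1, hk⟩ (Nat.le_succ k)
          have a3 := h1 ⟨k + 1, hk⟩ i hki
          have a4 := h2 ⟨k, by omega⟩ ⟨k + 1, hk⟩ (Nat.lt_succ_self k) (by omega)
          have a4 : (σ ⟨k, by omega⟩).1 < (σ ⟨k + 1, hk⟩).1 := a4
          omega
      exact key i.1 i.2 hi0 le_rfl
    have heven : ∀ i, ω (σ i) % 2 = 0 → σ i ≤ i := by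
      intro i hi
      obtain ⟨i1, hi1, hv, hc⟩ := hend i
      have key : ∀ (d k : ℕ) (hk : k < n), k + d = i1.1 → i.1 ≤ k → (σ ⟨k, hk⟩).1 ≤ k := by
        intro d
        induction d with
        | zero =>
          intro k hk hd _
          have e : (⟨k, hk⟩ : Fin n) = i1 := Fin.ext hd
          rw [e]
          have := (hA (σ i1)).2 (by rw [hv]; exact hi)
          rw [hv, hc] at this
          omega
        | succ d ih =>
          intro k hk hd hik
          have := i1.2
          have hk' := ih (k + 1) (by omega) (by omega) (by omega)
          have a1 := h1 i ⟨k, hk⟩ hik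
          have a2 := h1 ⟨k, hk⟩ ⟨k + 1, by omega⟩ (Nat.le_succ k)
          have a3 := h1 ⟨k + 1, by omega⟩ i1 (show k + 1 ≤ i1.1 by omega)
          have a4 := h2 ⟨k, hk⟩ ⟨k + 1, by omega⟩ (Nat.lt_succ_self k) (by omega)
          have a4 : (σ ⟨k, hk⟩).1 < (σ ⟨k + 1, by omega⟩).1 := a4
          omega
      have hii : i.1 ≤ i1.1 := hi1
      exact key (i1.1 - i.1) i.1 i.2 (by omega) le_rfl
    intro i
    refine ⟨hodd i, fun hlt => ?_⟩
    by_contra hc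
    exact (heven i (by omega)).not_gt hlt
  · intro hP j
    obtain ⟨i, rfl⟩ := σ.surjective j
    constructor
    · intro hi
      obtain ⟨i0, hi0, hv, hc⟩ := hstart i
      rw [hc]
      have b1 : i0.1 < (σ i0).1 := (hP i0).1 (by rw [hv]; exact hi)
      rcases hi0.eq_or_lt with e | e
      · rwa [← e]
      · have : (σ i0).1 < (σ i).1 := h2 i0 i e hv
        omega
    · intro hi
      obtain ⟨i1, hi1, hv, hc⟩ := hend i
      rw [hc]
      have b1 : ¬ i1 < σ i1 := fun hlt => by
        have := (hP i1).2 hlt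
        omega
      have b1 : (σ i1).1 ≤ i1.1 := not_lt.1 b1
      rcases eq_or_lt_of_le hi1 with e | e
      · rw [e]; omega
      · have : (σ i).1 < (σ i1).1 := h2 i i1 e hv.symm
        omega

end Sorting

/-! ### From coded words to permutations and drop sequences. -/

section CodeSum

variable {R : Type*} [CommRing R] {n : ℕ}

/-- Sum over coded words of the local weights. -/
noncomputable def codeSum (q t : R) (N n : ℕ) : R :=
  ∑ ω ∈ Fintype.piFinset fun _ : Fin n => range (2 * N),
    (∏ j : Fin n, locWt t N (content fun j => ω j / 2) j (ω j)) * q ^ ∑ j, ω j / 2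

theorem codeSum_eq_markedSum (q t : R) (N n : ℕ) : codeSum q t N n = markedSum q t t N n := by
  have hN : ∀ ω ∈ Fintype.piFinset (fun _ : Fin n => range (2 * N)), ∀ j, ω j / 2 < N := by
    intro ω hω j
    have := mem_range.1 (Fintype.mem_piFinset.1 hω j)
    omega
  unfold codeSum markedSum
  rw [← sum_fiberwise_of_maps_to (t := finsuppAntidiag (range N) n)
    (g := fun ω => content fun j => ω j / 2)
    (fun ω hω => content_mem_finsuppAntidiag (hN ω hω))]
  refine sum_congr rfl fun c hc => ?_
  rw [← coeff_prod_locWt t hc, coeff_prod_sum (range (2 * N)) (fun j a => locWt t N c j a) (· / 2),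
    mul_sum]
  refine sum_congr rfl fun ω hω => ?_
  obtain ⟨h1, h2⟩ := mem_filter.1 hω
  rw [← totalWt_content (hN ω h1), h2, mul_comm]

-- In decreasing order `2k + 1` precedes `2k`, so the block of `k` starts where the odd letters
-- start and ends where the even ones end. The conditions on uncoded letters thus become conditions
-- on coded ones.
open Classical in
theorem prod_locWt (t : R) {N : ℕ} {ω : Fin n → ℕ} (hω : ∀ j, ω j < 2 * N) :
    ∏ j : Fin n, locWt t N (content fun j => ω j / 2) j (ω j) =
      if Admissible ω then ∏ j, (if ω j % 2 = 1 then t else 1) else 0 := by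
  have hN : ∀ j, ω j / 2 < N := fun j => by have := hω j; omega
  have e : ∀ j : Fin n, locWt t N (content fun j => ω j / 2) j (ω j) =
      if (ω j % 2 = 1 → #{i | ω j < ω i} < j.1) ∧ (ω j % 2 = 0 → j.1 < #{i | ω j ≤ ω i}) then
        (if ω j % 2 = 1 then t else 1) else 0 := by
    intro j
    unfold locWt
    rw [tailCount_content hN, tailCount_content hN]
    rcases Nat.mod_two_eq_zero_or_one (ω j) with h | h
    · have : (univ.filter fun i => ω j / 2 ≤ ω i / 2) = univ.filter fun i => ω j ≤ ω i := by
        ext i; simp only [mem_filter, mem_univ, true_and]; omega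
      rw [this]
      simp [h]
    · have : (univ.filter fun i => ω j / 2 + 1 ≤ ω i / 2) = univ.filter fun i => ω j < ω i := by
        ext i; simp only [mem_filter, mem_univ, true_and]; omega
      rw [this]
      simp [h]
  rw [prod_congr rfl fun j _ => e j]
  by_cases h : Admissible ω
  · rw [if_pos h]
    exact prod_congr rfl fun j _ => if_pos (h j)
  · rw [if_neg h]
    obtain ⟨j, hj⟩ := not_forall.1 h
    exact prod_eq_zero (mem_univ j) (if_neg hj)

/-- The indicator of an excedance at the first position. -/
def firstExc (σ : Equiv.Perm (Fin n)) : ℕ := if ∃ h : 0 < n, (0 : ℕ) < σ ⟨0, h⟩ then 1 else 0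

/-- The indicator of an excedance. -/
def excInd (σ : Equiv.Perm (Fin n)) (i : Fin n) : ℕ := if i < σ i then 1 else 0

theorem excInd_le_one (σ : Equiv.Perm (Fin n)) (i : Fin n) : excInd σ i ≤ 1 := by
  unfold excInd; split_ifs <;> simp

theorem excInd_eq_one_iff (σ : Equiv.Perm (Fin n)) (i : Fin n) : excInd σ i = 1 ↔ i < σ i := by
  unfold excInd; split_ifs <;> simp_all

theorem firstExc_eq (σ : Equiv.Perm (Fin n)) (h : 0 < n) : firstExc σ = excInd σ ⟨0, h⟩ := by
  unfold firstExc excInd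
  refine if_congr ?_ rfl rfl
  exact ⟨fun ⟨_, h⟩ => h, fun h' => ⟨h, h'⟩⟩

theorem dsc_eq_one_iff (σ : Equiv.Perm (Fin n)) {i : ℕ} (h : i + 1 < n) :
    dsc σ i = 1 ↔ σ ⟨i + 1, h⟩ < σ ⟨i, by omega⟩ := by
  unfold dsc; rw [dif_pos h]; split_ifs <;> simp_all

theorem excInd_le_succ (σ : Equiv.Perm (Fin n)) {i : ℕ} (h : i + 1 < n) (hd : dsc σ i ≠ 1) :
    σ ⟨i, by omega⟩ < σ ⟨i + 1, h⟩ ∧ excInd σ ⟨i, by omega⟩ ≤ excInd σ ⟨i + 1, h⟩ := by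
  rw [Ne, dsc_eq_one_iff σ h, not_lt] at hd
  have hlt : σ ⟨i, by omega⟩ < σ ⟨i + 1, h⟩ := lt_of_le_of_ne hd fun e => by
    have := congrArg Fin.val (σ.injective e)
    simp at this
  refine ⟨hlt, ?_⟩
  have e1 := excInd_eq_one_iff σ ⟨i, by omega⟩
  have e2 := excInd_eq_one_iff σ ⟨i + 1, h⟩
  have e3 := excInd_le_one σ ⟨i, by omega⟩
  by_contra hc
  have hi : i < (σ ⟨i, by omega⟩).1 := e1.1 (by omega)
  have hlt' : (σ ⟨i, by omega⟩).1 < (σ ⟨i + 1, h⟩).1 := hlt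
  have : i + 1 < (σ ⟨i + 1, h⟩).1 := by omega
  have := e2.2 this
  omega

/-- If `b i = 0`, all later entries and drops vanish, so `σ` increases from `i` to the end and `σ i
≤ i`. This keeps the subtraction in `2 * b - excInd` from truncating. -/
theorem excInd_le_of_drops (σ : Equiv.Perm (Fin n)) (b : Fin n → ℕ)
    (hb : ∀ (i : ℕ) (h : i + 1 < n), b ⟨i + 1, h⟩ + dsc σ i ≤ b ⟨i, by omega⟩) (i : Fin n) :
    excInd σ i ≤ b i := by
  have key : ∀ (d i : ℕ) (hi : i < n), i + d + 1 = n → b ⟨i, hi⟩ = 0 → (σ ⟨i, hi⟩).1 ≤ i := by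
    intro d
    induction d with
    | zero => intro i hi hd _; have := (σ ⟨i, hi⟩).2; omega
    | succ d ih =>
      intro i hi hd h0
      have h1 := hb i (by omega)
      have h2 := ih (i + 1) (by omega) (by omega) (by omega)
      have h3 : (σ ⟨i, by omega⟩).1 < (σ ⟨i + 1, by omega⟩).1 :=
        (excInd_le_succ σ (i := i) (by omega) (by omega)).1
      omega
  by_contra hc
  have h1 := excInd_le_one σ i
  have h2 : i.1 < (σ i).1 := (excInd_eq_one_iff σ i).1 (by omega)
  have := key (n - 1 - i.1) i.1 i.2 (by omega) (by change b i = 0; omega)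
  change (σ i).1 ≤ i.1 at this
  omega

theorem sum_admissible_sorted (q s t : R) (hst : s * q = t) (N : ℕ) (σ : Equiv.Perm (Fin n)) :
    ∑ ω ∈ Fintype.piFinset (fun _ : Fin n => range (2 * N)) with sortPerm ω = σ,
      (∏ j : Fin n, locWt t N (content fun j => ω j / 2) j (ω j)) * q ^ ∑ j, ω j / 2 =
    s ^ exc σ * dropSum q (N + firstExc σ) n (dsc σ) := by
  classical
  have hL : ∑ ω ∈ Fintype.piFinset (fun _ : Fin n => range (2 * N)) with sortPerm ω = σ,
      (∏ j : Fin n, locWt t N (content fun j => ω j / 2) j (ω j)) * q ^ ∑ j, ω j / 2 =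
      ∑ ω ∈ Fintype.piFinset (fun _ : Fin n => range (2 * N)) with
        (Sorts σ ω ∧ ∀ i, ω (σ i) % 2 = 1 ↔ i < σ i),
      (∏ j, (if ω j % 2 = 1 then t else 1)) * q ^ ∑ j, ω j / 2 := by
    rw [sum_filter, sum_filter]
    refine sum_congr rfl fun ω hω => ?_
    rw [prod_locWt t fun j => mem_range.1 (Fintype.mem_piFinset.1 hω j)]
    by_cases hS : Sorts σ ω
    · rw [if_pos ((sortPerm_eq_iff σ ω).2 hS)]
      simp only [admissible_iff hS]
      by_cases hA : ∀ i, ω (σ i) % 2 = 1 ↔ i < σ i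
      · rw [if_pos hA, if_pos ⟨hS, hA⟩]
      · rw [if_neg hA, if_neg fun h => hA h.2, zero_mul]
    · rw [if_neg fun h => hS ((sortPerm_eq_iff σ ω).1 h), if_neg fun h => hS h.1]
  rw [hL, dropSum, mul_sum]
  -- Halving with rounding up raises the halved letter by one exactly at excedances, which turns the
  -- weight `t` into `s = t / q`. Parity is recovered from the excedances of `σ`.
  refine sum_nbij' (fun ω i => (ω (σ i) + 1) / 2)
    (fun b j => 2 * b (σ.symm j) - excInd σ (σ.symm j)) ?_ ?_ ?_ ?_ ?_
  · intro ω hω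
    obtain ⟨h1, ⟨h2, h3⟩, h4⟩ := mem_filter.1 hω
    have h1 : ∀ j, ω j < 2 * N := fun j => mem_range.1 (Fintype.mem_piFinset.1 h1 j)
    refine mem_filter.2 ⟨Fintype.mem_piFinset.2 fun i => mem_range.2 ?_, fun i hi => ?_⟩
    -- The first sorted letter is the largest; `ω < 2N` there means `b < N` after rounding up, or `b
    -- < N + 1` at an excedance, whence `firstExc`.
    · have hn : 0 < n := i.pos
      have a1 := h2 ⟨0, hn⟩ i (Nat.zero_le _)
      have a2 := h1 (σ ⟨0, hn⟩)
      have a3 := h4 ⟨0, hn⟩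
      rw [← excInd_eq_one_iff] at a3
      rw [firstExc_eq σ hn]
      have a4 := excInd_le_one σ ⟨0, hn⟩
      omega
    · have a1 := h2 ⟨i, by omega⟩ ⟨i + 1, hi⟩ (Nat.le_succ i)
      dsimp only
      by_cases hd : dsc σ i = 1
      · have hd' := (dsc_eq_one_iff σ hi).1 hd
        have a2 : ω (σ ⟨i, by omega⟩) ≠ ω (σ ⟨i + 1, hi⟩) := fun e =>
          (h3 _ _ (Nat.lt_succ_self i) e).asymm hd'
        have a3 := h4 ⟨i, by omega⟩
        have a4 := h4 ⟨i + 1, hi⟩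
        -- Distinct letters round up to the same value only as `2k` and `2k - 1`. A descent excludes
        -- this order of parities: an excedance at `i + 1` forces one at `i`.
        have a5 : ω (σ ⟨i + 1, hi⟩) % 2 = 1 → ω (σ ⟨i, by omega⟩) % 2 = 1 := by
          intro h
          have b1 : i + 1 < (σ ⟨i + 1, hi⟩).1 := a4.1 h
          have b2 : (σ ⟨i + 1, hi⟩).1 < (σ ⟨i, by omega⟩).1 := hd'
          exact a3.2 (show i < (σ ⟨i, by omega⟩).1 by omega)
        omega
      · have := dsc_le_one σ i
        omega
  · intro b hb
    obtain ⟨h1, h2⟩ := mem_filter.1 hb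
    have h1 : ∀ j, b j < N + firstExc σ := fun j => mem_range.1 (Fintype.mem_piFinset.1 h1 j)
    have hpos := excInd_le_of_drops σ b h2
    have hS : Sorts σ fun j => 2 * b (σ.symm j) - excInd σ (σ.symm j) := by
      refine sorts_of_adjacent fun i hi => ?_
      simp only [Equiv.symm_apply_apply]
      have a1 := h2 i hi
      have a2 := excInd_le_one σ ⟨i, by omega⟩
      have a3 := excInd_le_one σ ⟨i + 1, hi⟩
      have a4 := hpos ⟨i, by omega⟩
      have a5 := hpos ⟨i + 1, hi⟩
      by_cases hd : dsc σ i = 1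
      · exact ⟨by omega, fun h => by omega⟩
      · obtain ⟨a6, a7⟩ := excInd_le_succ σ hi hd
        exact ⟨by omega, fun _ => a6⟩
    refine mem_filter.2 ⟨Fintype.mem_piFinset.2 fun j => mem_range.2 ?_, hS, fun i => ?_⟩
    · obtain ⟨i, rfl⟩ := σ.surjective j
      have hn : 0 < n := i.pos
      have a1 := hS.1 ⟨0, hn⟩ i (Nat.zero_le _)
      refine a1.trans_lt ?_
      simp only [Equiv.symm_apply_apply]
      have a2 := h1 ⟨0, hn⟩
      rw [firstExc_eq σ hn] at a2
      have a3 := hpos ⟨0, hn⟩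
      have a4 := excInd_le_one σ ⟨0, hn⟩
      omega
    · simp only [Equiv.symm_apply_apply]
      have a1 := excInd_le_one σ i
      have a2 := hpos i
      rw [← excInd_eq_one_iff]
      omega
  · intro ω hω
    obtain ⟨-, -, h4⟩ := mem_filter.1 hω
    funext j
    obtain ⟨i, rfl⟩ := σ.surjective j
    simp only [Equiv.symm_apply_apply]
    have a1 := h4 i
    rw [← excInd_eq_one_iff] at a1
    have a2 := excInd_le_one σ i
    omega
  · intro b hb
    obtain ⟨-, h2⟩ := mem_filter.1 hb
    funext i
    simp only [Equiv.symm_apply_apply]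
    have a1 := excInd_le_one σ i
    have a2 := excInd_le_of_drops σ b h2 i
    omega
  · intro ω hω
    obtain ⟨-, -, h4⟩ := mem_filter.1 hω
    have e : s ^ exc σ = ∏ i, (if i < σ i then s else 1) := by
      rw [exc_eq, ← prod_const, prod_filter]
    rw [e, ← prod_pow_eq_pow_sum, ← prod_pow_eq_pow_sum, ← prod_mul_distrib, ← prod_mul_distrib,
      ← Equiv.prod_comp σ]
    refine prod_congr rfl fun i _ => ?_
    by_cases h : i < σ i
    · have hp := (h4 i).2 h
      rw [if_pos hp, if_pos h, ← hst, show (ω (σ i) + 1) / 2 = ω (σ i) / 2 + 1 by omega, pow_succ]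
      ring
    · have hp : ¬ ω (σ i) % 2 = 1 := fun hp => h ((h4 i).1 hp)
      rw [if_neg hp, if_neg h, show (ω (σ i) + 1) / 2 = ω (σ i) / 2 by omega]

theorem sum_perm_eq_markedSum (q s t : R) (hst : s * q = t) (N n : ℕ) :
    ∑ σ : Equiv.Perm (Fin n), s ^ exc σ * dropSum q (N + firstExc σ) n (dsc σ) =
      markedSum q t t N n := by
  rw [← codeSum_eq_markedSum, codeSum, ← sum_fiberwise _ sortPerm]
  exact sum_congr rfl fun σ _ => (sum_admissible_sorted q s t hst N σ).symm

end CodeSum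

end QEulerGamma

namespace QEulerGamma

open Finset QBinEul Filter

/-! ### Formal limits as `N → ∞`. -/

section Limit

variable {R : Type*} [CommRing R]

/-- `f N` is eventually a polynomial in `q ^ N` with constant term `a`. -/
def HasQLim (q : R) (f : ℕ → R) (a : R) : Prop :=
  ∃ P : Polynomial R, P.eval 0 = a ∧ ∀ᶠ N in atTop, f N = P.eval (q ^ N)

theorem hasQLim_const (q a : R) : HasQLim q (fun _ => a) a :=
  ⟨Polynomial.C a, by simp, by simp⟩

theorem HasQLim.add {q : R} {f g : ℕ → R} {a b : R} (hf : HasQLim q f a) (hg : HasQLim q g b) :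
    HasQLim q (fun N => f N + g N) (a + b) := by
  obtain ⟨P, hP, hf⟩ := hf
  obtain ⟨Q, hQ, hg⟩ := hg
  refine ⟨P + Q, by simp [hP, hQ], ?_⟩
  filter_upwards [hf, hg] with N h1 h2
  simp [h1, h2]

theorem HasQLim.mul {q : R} {f g : ℕ → R} {a b : R} (hf : HasQLim q f a) (hg : HasQLim q g b) :
    HasQLim q (fun N => f N * g N) (a * b) := by
  obtain ⟨P, hP, hf⟩ := hf
  obtain ⟨Q, hQ, hg⟩ := hg
  refine ⟨P * Q, by simp [hP, hQ], ?_⟩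
  filter_upwards [hf, hg] with N h1 h2
  simp [h1, h2]

theorem HasQLim.const_mul {q : R} {f : ℕ → R} {a : R} (c : R) (hf : HasQLim q f a) :
    HasQLim q (fun N => c * f N) (c * a) :=
  (hasQLim_const q c).mul hf

theorem HasQLim.sub {q : R} {f g : ℕ → R} {a b : R} (hf : HasQLim q f a) (hg : HasQLim q g b) :
    HasQLim q (fun N => f N - g N) (a - b) := by
  simpa only [neg_one_mul, ← sub_eq_add_neg] using hf.add (hg.const_mul (-1))

theorem hasQLim_sum {ι : Type*} {q : R} (s : Finset ι) {f : ι → ℕ → R} {a : ι → R}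
    (h : ∀ i ∈ s, HasQLim q (f i) (a i)) :
    HasQLim q (fun N => ∑ i ∈ s, f i N) (∑ i ∈ s, a i) := by
  classical
  induction s using Finset.induction_on with
  | empty => simpa using hasQLim_const q 0
  | insert i s hi ih =>
    simp only [sum_insert hi]
    exact (h i (mem_insert_self i s)).add (ih fun j hj => h j (mem_insert_of_mem hj))

theorem hasQLim_prod_one {ι : Type*} {q : R} (s : Finset ι) {f : ι → ℕ → R}
    (h : ∀ i ∈ s, HasQLim q (f i) 1) :
    HasQLim q (fun N => ∏ i ∈ s, f i N) 1 := by
  classical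
  induction s using Finset.induction_on with
  | empty => simpa using hasQLim_const q 1
  | insert i s hi ih =>
    simp only [prod_insert hi]
    simpa using (h i (mem_insert_self i s)).mul (ih fun j hj => h j (mem_insert_of_mem hj))

theorem HasQLim.congr' {q : R} {f g : ℕ → R} {a : R} (hf : HasQLim q f a)
    (h : ∀ᶠ N in atTop, g N = f N) : HasQLim q g a := by
  obtain ⟨P, hP, hf⟩ := hf
  refine ⟨P, hP, ?_⟩
  filter_upwards [hf, h] with N h1 h2
  rw [h2, h1]

/-- Invertibility of `q` is needed to write `q^(N + a - b)` as a constant times `q^N`, once `N ≥ b`.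
-/
theorem hasQLim_pow {q qi : R} (hq : q * qi = 1) (a b : ℕ) :
    HasQLim q (fun N => q ^ (N + a - b)) 0 := by
  refine ⟨Polynomial.C (q ^ a * qi ^ b) * Polynomial.X, by simp, ?_⟩
  filter_upwards [eventually_ge_atTop b] with N hN
  have h1 : q ^ (N + a - b) * q ^ b = q ^ N * q ^ a := by
    rw [← pow_add, ← pow_add]; congr 1; omega
  have h2 : q ^ b * qi ^ b = 1 := by rw [← mul_pow, hq, one_pow]
  simp only [Polynomial.eval_mul, Polynomial.eval_C, Polynomial.eval_X]
  linear_combination qi ^ b * h1 - q ^ (N + a - b) * h2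

/-- Two polynomials agreeing at the infinitely many points `q^N` coincide. -/
theorem HasQLim.unique [IsDomain R] {q : R} (hq : Function.Injective fun k : ℕ => q ^ k)
    {f : ℕ → R} {a b : R} (ha : HasQLim q f a) (hb : HasQLim q f b) : a = b := by
  obtain ⟨P, hP, hf⟩ := ha
  obtain ⟨Q, hQ, hg⟩ := hb
  obtain ⟨M, hM⟩ := eventually_atTop.1 (hf.and hg)
  have : P = Q := by
    refine Polynomial.eq_of_infinite_eval_eq P Q ?_
    refine ((Set.Ici_infinite M).image hq.injOn).mono ?_
    rintro _ ⟨N, hN, rfl⟩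
    obtain ⟨h1, h2⟩ := hM N hN
    exact h1.symm.trans h2
  rw [← hP, ← hQ, this]

end Limit

/-! ### The limiting relations and their inversion. -/

section Relations

variable {R : Type*} [CommRing R]

theorem hasQLim_es {q qi : R} (hq : q * qi = 1) (j : ℕ) :
    HasQLim q (fun N => qp q j * es q j N) (q ^ j.choose 2) := by
  simp only [qp_mul_es]
  have := (hasQLim_prod_one (q := q) (range j) (f := fun i N => 1 - q ^ (N - i)) fun i _ => by
    simpa using (hasQLim_const q 1).sub (hasQLim_pow hq 0 i)).const_mul (q ^ j.choose 2)
  simpa using this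

/-- The sum of `s ^ exc * q ^ maj` over permutations. -/
noncomputable def excMajSum (q s : R) (n : ℕ) : R :=
  ∑ σ : Equiv.Perm (Fin n), s ^ exc σ * q ^ maj σ

/-- All factors `1 - q^(N + …)` tend to `1`. In particular the shift `e`, used for `firstExc`,
disappears. -/
theorem hasQLim_dropSum {q qi : R} (hq : q * qi = 1) {n : ℕ} (σ : Equiv.Perm (Fin n)) (e : ℕ) :
    HasQLim q (fun N => qp q n * dropSum q (N + e) n (dsc σ)) (q ^ maj σ) := by
  rcases n with _ | n
  · simp only [dropSum_zero, maj_eq]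
    simpa [qp] using hasQLim_const q 1
  · rw [maj_eq, Nat.add_sub_cancel]
    have h1 := (hasQLim_prod_one (q := q) (range (n + 1))
      (f := fun i N => 1 - q ^ (N + (e + i) - ∑ k ∈ range n, dsc σ k)) fun i _ => by
      simpa using (hasQLim_const q 1).sub (hasQLim_pow hq (e + i) _)).const_mul
        (q ^ ∑ i ∈ range n, (i + 1) * dsc σ i)
    rw [mul_one] at h1
    refine h1.congr' ?_
    filter_upwards [eventually_ge_atTop (∑ k ∈ range n, dsc σ k)] with N hN
    have h2 := qp_mul_dropSum q n (N + e - ∑ k ∈ range n, dsc σ k) (dsc σ)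
    rw [Nat.sub_add_cancel (by omega)] at h2
    rw [h2]
    congr 1
    refine prod_congr rfl fun i _ => ?_
    rw [show N + e - ∑ k ∈ range n, dsc σ k + i = N + (e + i) - ∑ k ∈ range n, dsc σ k by omega]

theorem hasQLim_markedSum {q qi s t : R} (hq : q * qi = 1) (hst : s * q = t) (n : ℕ) :
    HasQLim q (fun N => qp q n * markedSum q t t N n) (excMajSum q s n) := by
  simp only [← sum_perm_eq_markedSum q s t hst, mul_sum, excMajSum]
  refine hasQLim_sum _ fun σ _ => ?_
  simp only [mul_left_comm (qp q n)]
  exact (hasQLim_dropSum hq σ _).const_mul _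

variable {q qi s t : R} {B : ℕ → ℕ → R}

theorem qp_mul_markedSum (hB : ∀ n j, j ≤ n → B n j * (qp q j * qp q (n - j)) = qp q n)
    (τ : R) (N n : ℕ) :
    qp q n * markedSum q t τ N n = ∑ j ∈ range (n + 1), (-τ) ^ j * B n j * (qp q j * es q j N) *
      (qp q (n - j) * plainSum q t N (n - j)) := by
  rw [markedSum_eq, mul_sum]
  refine sum_congr rfl fun j hj => ?_
  rw [← hB n j (by have := mem_range.1 hj; omega)]; ring

/-- The expansion of `markedSum` is unitriangular in `plainSum`, so limits pass from one to the
other by induction. -/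
theorem exists_hasQLim_plainSum (hq : q * qi = 1) (hst : s * q = t)
    (hB : ∀ n j, j ≤ n → B n j * (qp q j * qp q (n - j)) = qp q n) (hB0 : ∀ n, B n 0 = 1) (n : ℕ) :
    ∃ a, HasQLim q (fun N => qp q n * plainSum q t N n) a := by
  induction n using Nat.strong_induction_on with
  | _ n ih =>
  choose! F hF using ih
  refine ⟨_, HasQLim.congr' ((hasQLim_markedSum hq hst n).sub (hasQLim_sum (range n)
    (f := fun j N => (-t) ^ (j + 1) * B n (j + 1) * (qp q (j + 1) * es q (j + 1) N) *
      (qp q (n - (j + 1)) * plainSum q t N (n - (j + 1)))) fun j hj =>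
    ((hasQLim_es hq (j + 1)).const_mul _).mul
      (hF (n - (j + 1)) (by have := mem_range.1 hj; omega)))) (Eventually.of_forall fun N => ?_)⟩
  rw [qp_mul_markedSum hB, sum_range_succ']
  simp [hB0, es_zero, qp]

theorem prod_mul_qp (q : R) {j n : ℕ} (h : j ≤ n) :
    (∏ i ∈ range j, (1 - q ^ (n - i))) * qp q (n - j) = qp q n := by
  induction j with
  | zero => simp
  | succ j ih =>
    rw [← ih (by omega), prod_range_succ, mul_assoc]
    congr 1
    obtain ⟨m, rfl⟩ := Nat.exists_eq_add_of_lt (show j < n by omega)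
    rw [show j + m + 1 - j = m + 1 by omega, show j + m + 1 - (j + 1) = m by omega, qp_succ, mul_comm]

theorem qp_ne_zero [IsDomain R] (hinj : Function.Injective fun k : ℕ => q ^ k) (n : ℕ) :
    qp q n ≠ 0 := by
  refine prod_ne_zero_iff.2 fun i _ h => ?_
  have : (fun k : ℕ => q ^ k) 0 = (fun k : ℕ => q ^ k) (i + 1) := by
    simpa using sub_eq_zero.1 h
  exact absurd (hinj this) (by omega)

theorem binom_mul_pow_eq_es [IsDomain R] (hinj : Function.Injective fun k : ℕ => q ^ k)
    (hB : ∀ n j, j ≤ n → B n j * (qp q j * qp q (n - j)) = qp q n) {n j : ℕ} (h : j ≤ n) :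
    B n j * q ^ j.choose 2 = es q j n := by
  refine mul_right_cancel₀ (mul_ne_zero (qp_ne_zero hinj j) (qp_ne_zero hinj (n - j))) ?_
  have h1 := qp_mul_es q j n
  have h2 := prod_mul_qp q h
  linear_combination q ^ j.choose 2 * hB n j h - q ^ j.choose 2 * h2 - qp q (n - j) * h1

theorem exists_relations [IsDomain R] (hinj : Function.Injective fun k : ℕ => q ^ k)
    (hq : q * qi = 1) (hst : s * q = t)
    (hB : ∀ n j, j ≤ n → B n j * (qp q j * qp q (n - j)) = qp q n) (hB0 : ∀ n, B n 0 = 1) :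
    ∃ F : ℕ → R, ∀ n,
      excMajSum q s n = ∑ j ∈ range (n + 1), (-t) ^ j * es q j n * F (n - j) ∧
      (if n = 0 then 1 - t else 0) + t * excMajSum q s n =
        ∑ j ∈ range (n + 1), (-1) ^ j * es q j n * F (n - j) := by
  choose F hF using fun n => exists_hasQLim_plainSum hq hst hB hB0 n
  have hlim : ∀ τ n, HasQLim q (fun N => qp q n * markedSum q t τ N n)
      (∑ j ∈ range (n + 1), (-τ) ^ j * es q j n * F (n - j)) := by
    intro τ n
    simp only [qp_mul_markedSum hB]
    have := hasQLim_sum (q := q) (range (n + 1)) fun j _ =>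
      ((hasQLim_es hq j).const_mul ((-τ) ^ j * B n j)).mul (hF (n - j))
    convert! this using 1
    refine sum_congr rfl fun j hj => ?_
    rw [← binom_mul_pow_eq_es hinj hB (show j ≤ n by have := mem_range.1 hj; omega)]
    ring
  refine ⟨F, fun n => ⟨(hasQLim_markedSum hq hst n).unique hinj (hlim t n), ?_⟩⟩
  refine HasQLim.unique hinj ?_ (hlim 1 n)
  simp only [markedSum_one]
  have := (hasQLim_const q (if n = 0 then 1 - t else 0)).add
    ((hasQLim_markedSum hq hst n).const_mul t)
  refine this.congr' (Eventually.of_forall fun N => ?_)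
  rcases n with _ | n
  · simp [qp]
  · simp; ring

/-- Eliminating `A n` leaves the coefficients `1 - t^(j+1)`; dividing by `1 - t` gives the
recurrence of `gammaSum`, whose `j = 0` term determines the solution. -/
theorem eq_gammaSum_of_relations [IsDomain R] (ht : t ≠ 1) {A F : ℕ → R}
    (h : ∀ n, A n = ∑ j ∈ range (n + 1), (-t) ^ j * es q j n * F (n - j) ∧
      (if n = 0 then 1 - t else 0) + t * A n =
        ∑ j ∈ range (n + 1), (-1) ^ j * es q j n * F (n - j)) (n : ℕ) :
    F n = gammaSum q t n := by
  have hrec : ∀ n, ∑ j ∈ range (n + 1), (-1) ^ j * tn t (j + 1) * es q j n * F (n - j) =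
      if n = 0 then 1 else 0 := by
    intro n
    refine mul_left_cancel₀ (sub_ne_zero.2 ht.symm) ?_
    obtain ⟨h1, h2⟩ := h n
    have e : (1 - t) * ∑ j ∈ range (n + 1), (-1) ^ j * tn t (j + 1) * es q j n * F (n - j) =
        ∑ j ∈ range (n + 1), (-1) ^ j * es q j n * F (n - j) -
          t * ∑ j ∈ range (n + 1), (-t) ^ j * es q j n * F (n - j) := by
      rw [mul_sum, mul_sum, ← sum_sub_distrib]
      refine sum_congr rfl fun j _ => ?_
      have := one_sub_mul_tn t (j + 1)
      rw [neg_pow t j]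
      linear_combination (-1) ^ j * es q j n * F (n - j) * this
    rw [e, ← h2, ← h1]
    split_ifs <;> ring
  induction n using Nat.strong_induction_on with
  | _ n ih =>
  have h1 := hrec n
  have h2 := gammaSum_recurrence q t n
  rw [sum_range_succ'] at h1 h2
  have e : ∑ j ∈ range n, (-1) ^ (j + 1) * tn t (j + 1 + 1) * es q (j + 1) n * F (n - (j + 1)) =
      ∑ j ∈ range n, (-1) ^ (j + 1) * tn t (j + 1 + 1) * es q (j + 1) n *
        gammaSum q t (n - (j + 1)) := by
    refine sum_congr rfl fun j hj => ?_
    rw [ih (n - (j + 1)) (by have := mem_range.1 hj; omega)]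
  rw [e] at h1
  have := add_left_cancel (h1.trans h2.symm)
  simpa [tn, es_zero] using this

/-- `q`-binomial inversion: after trinomial revision, the coefficient of `F k` is an alternating sum
of `e_j(n - k)`, which vanishes unless `k = n`. -/
theorem eq_sum_binom_of_relation [IsDomain R] (hinj : Function.Injective fun k : ℕ => q ^ k)
    (hB : ∀ n j, j ≤ n → B n j * (qp q j * qp q (n - j)) = qp q n) {A F : ℕ → R}
    (h : ∀ n, A n = ∑ j ∈ range (n + 1), (-1) ^ j * es q j n * F (n - j)) (n : ℕ) :
    F n = ∑ m ∈ range (n + 1), B n m * A m := by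
  have e1 : ∀ m ∈ range (n + 1), B n m * A m = ∑ k ∈ range (m + 1),
      (fun k j => B n k * F k * ((-1) ^ j * es q j (n - k))) k (m - k) := by
    intro m hm
    have hm := mem_range.1 hm
    rw [h, mul_sum, ← sum_range_reflect]
    refine sum_congr rfl fun k hk => ?_
    have hk := mem_range.1 hk
    have e : B n m * es q (m - k) m = B n k * es q (m - k) (n - k) := by
      rw [← binom_mul_pow_eq_es hinj hB (show m - k ≤ m by omega),
        ← binom_mul_pow_eq_es hinj hB (show m - k ≤ n - k by omega)]
      have hne := qp_ne_zero hinj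
      refine mul_right_cancel₀ (mul_ne_zero (mul_ne_zero (hne (m - k)) (hne k)) (hne (n - m))) ?_
      have b1 := hB n m (by omega)
      have b2 := hB m (m - k) (by omega)
      have b3 := hB n k (by omega)
      have b4 := hB (n - k) (m - k) (by omega)
      rw [show m - (m - k) = k by omega] at b2
      rw [show n - k - (m - k) = n - m by omega] at b4
      linear_combination q ^ (m - k).choose 2 * (B n m * qp q (n - m) * b2 + b1 -
        B n k * qp q k * b4 - b3)
    rw [show m + 1 - 1 - k = m - k by omega, show m - (m - k) = k by omega]
    linear_combination (-1) ^ (m - k) * F k * e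
  have hBn : B n n = 1 := by
    have := binom_mul_pow_eq_es hinj hB (le_refl n)
    have b := hB n n le_rfl
    rw [Nat.sub_self] at b
    refine mul_right_cancel₀ (qp_ne_zero hinj n) ?_
    simpa [qp] using b
  rw [sum_congr rfl e1, sum_range_diag_flip (n + 1)
    (fun k j => B n k * F k * ((-1) ^ j * es q j (n - k)))]
  simp only [← mul_sum]
  rw [sum_range_succ, sum_eq_zero]
  · simp [hBn, es_zero]
  · intro k hk
    have hk := mem_range.1 hk
    rw [show n + 1 - k = n - k + 1 by omega, sum_neg_one_pow_mul_es, if_neg (by omega), mul_zero]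

end Relations

/-! ### Specialisation to `ℚ(q)[t]`. -/

section Concrete

theorem qp_eq (n : ℕ) : qp (Polynomial.C q) n = Polynomial.C (qPoch n) := by
  unfold qp qPoch
  rw [show Icc 1 n = Ico 1 (n + 1) from rfl, prod_Ico_eq_prod_range, map_prod, Nat.add_sub_cancel]
  refine prod_congr rfl fun i _ => ?_
  rw [add_comm 1 i]; simp

theorem pow_q_injective : Function.Injective fun k : ℕ => (q : RatFunc ℚ) ^ k := by
  intro a b h
  have h' : algebraMap (Polynomial ℚ) (RatFunc ℚ) (Polynomial.X ^ a) =
      algebraMap (Polynomial ℚ) (RatFunc ℚ) (Polynomial.X ^ b) := by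
    simpa [RatFunc.algebraMap_X] using h
  have := congrArg Polynomial.natDegree (RatFunc.algebraMap_injective ℚ h')
  simpa using this

theorem pow_C_q_injective :
    Function.Injective fun k : ℕ => (Polynomial.C q : Polynomial (RatFunc ℚ)) ^ k := by
  intro a b h
  refine pow_q_injective (Polynomial.C_injective ?_)
  simpa using h

theorem qPoch_ne_zero (n : ℕ) : qPoch n ≠ 0 := by
  have := qp_ne_zero pow_C_q_injective n
  rw [qp_eq] at this
  exact fun h => this (by rw [h, map_zero])

theorem C_qBinom_mul (n j : ℕ) (_ : j ≤ n) :
    Polynomial.C (qBinom n j) * (qp (Polynomial.C q) j * qp (Polynomial.C q) (n - j)) =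
      qp (Polynomial.C q) n := by
  rw [qp_eq, qp_eq, qp_eq, ← map_mul, ← map_mul, qBinom,
    div_mul_cancel₀ _ (mul_ne_zero (qPoch_ne_zero _) (qPoch_ne_zero _))]

theorem qBinom_zero_right (n : ℕ) : qBinom n 0 = 1 := by
  have : qPoch 0 = 1 := by simp [qPoch]
  rw [qBinom, this, one_mul, Nat.sub_zero, div_self (qPoch_ne_zero n)]

theorem excMajSum_eq (n : ℕ) :
    excMajSum (Polynomial.C q) (Polynomial.C q⁻¹ * t) n = qEulerian n := by
  unfold excMajSum qEulerian
  refine sum_congr rfl fun σ _ => ?_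
  rw [mul_pow, zpow_sub₀ RatFunc.X_ne_zero, zpow_natCast, zpow_natCast, div_eq_mul_inv, map_mul,
    ← inv_pow, map_pow, map_pow]
  ring

theorem qEulerian_zero : qEulerian 0 = 1 := by
  simp [qEulerian, exc_eq, maj_eq]

theorem gammaSum_eq (n : ℕ) : gammaSum (Polynomial.C q) t n =
    ∑ k ∈ range (n / 2 + 1), Polynomial.C (gammaCoeff n k) * (t ^ k * (1 + t) ^ (n - 2 * k)) := by
  have hdes : ∀ σ : Equiv.Perm (Fin n), ∑ i ∈ range n, dsc σ i = des σ := by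
    intro σ
    rw [des_eq]
    symm
    refine sum_subset (range_subset_range.2 (Nat.sub_le _ _)) fun i _ hi => dsc_eq_zero σ ?_
    have := mt mem_range.2 hi
    omega
  have h1 : gammaSum (Polynomial.C q) t n = ∑ σ : Equiv.Perm (Fin n) with dd σ = 0,
      Polynomial.C q ^ QBinEul.inv σ * (t ^ des σ * (1 + t) ^ (n - 2 * des σ)) := by
    rw [gammaSum, sum_filter]
    refine sum_congr rfl fun σ _ => ?_
    unfold wtd
    rw [hdes]
    simp only [← dd_eq_zero_iff, mul_ite, mul_zero]
  rw [h1, ← sum_fiberwise_of_maps_to (g := des) (t := range (n / 2 + 1))]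
  · refine sum_congr rfl fun k _ => ?_
    rw [gammaCoeff, map_sum, sum_mul, gammaSet, filter_filter]
    refine sum_congr rfl fun σ hσ => ?_
    rw [(mem_filter.1 hσ).2.2, map_pow]
  · intro σ hσ
    have h2 := two_mul_sum_le n (dsc σ) (dsc_le_one σ) (fun i => dsc_eq_zero σ)
      ((dd_eq_zero_iff σ).1 (mem_filter.1 hσ).2)
    rw [hdes] at h2
    exact mem_range.2 (by omega)

/-- As `A_0 = 1`, the `m = 0` term is `(1 - t) + t = 1`, the isolated summand of the definition. -/
theorem qBinomialEulerian_eq (n : ℕ) : qBinomialEulerian n = ∑ m ∈ range (n + 1),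
    Polynomial.C (qBinom n m) * ((if m = 0 then 1 - t else 0) + t * qEulerian m) := by
  rw [sum_range_succ', if_pos rfl, qEulerian_zero, qBinom_zero_right, qBinomialEulerian,
    show Icc 1 n = Ico 1 (n + 1) from rfl, sum_Ico_eq_sum_range, Nat.add_sub_cancel, mul_sum, map_one]
  rw [add_comm]
  congr 1
  · refine sum_congr rfl fun m _ => ?_
    rw [if_neg (by omega), add_comm 1 m]; ring
  · ring

end Concrete

end QEulerGamma

theorem theorem1p2 (n : ℕ) :
    QBinEul.qBinomialEulerian n =
      ∑ k ∈ Finset.range (n / 2 + 1),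
        Polynomial.C (QBinEul.gammaCoeff n k) *
          (QBinEul.t ^ k * (1 + QBinEul.t) ^ (n - 2 * k)) := by
  have hq : (Polynomial.C QBinEul.q : Polynomial (RatFunc ℚ)) * Polynomial.C QBinEul.q⁻¹ = 1 := by
    rw [← map_mul, mul_inv_cancel₀ RatFunc.X_ne_zero, map_one]
  have hst : Polynomial.C QBinEul.q⁻¹ * QBinEul.t * Polynomial.C QBinEul.q = QBinEul.t := by
    linear_combination QBinEul.t * hq
  obtain ⟨F, hF⟩ := QEulerGamma.exists_relations (B := fun n m => Polynomial.C (QBinEul.qBinom n m))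
    QEulerGamma.pow_C_q_injective hq hst QEulerGamma.C_qBinom_mul
    (fun n => by rw [QEulerGamma.qBinom_zero_right, map_one])
  simp only [QEulerGamma.excMajSum_eq] at hF
  have ht : QBinEul.t ≠ 1 := fun h => by
    simpa using congrArg Polynomial.natDegree h
  rw [← QEulerGamma.gammaSum_eq, ← QEulerGamma.eq_gammaSum_of_relations ht hF n,
    QEulerGamma.qBinomialEulerian_eq]
  exact (QEulerGamma.eq_sum_binom_of_relation QEulerGamma.pow_C_q_injective QEulerGamma.C_qBinom_mul
    (fun n => (hF n).2) n).symm
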